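/- Let $Q$ be a smooth manifold with a mechanical Lagrangian $L=\tfrac12\kappa-U$ (with $\kappa$ a Riemannian metric and $U$ a smooth function) and a smooth constant-rank constraint distribution $D\subset TQ$. Put $\mathcal M=\kappa^\sharp(D)\subset T^*Q$ and let $X_{\rm nh}$ be the nonholonomic vector field on $\mathcal M$, defined by $\mathbf i_{X_{\rm nh}}\Omega_Q|_{\mathcal C}=dH|_{\mathcal C}$ with $X_{\rm nh}\in\mathcal C=\{v\in T\mathcal M: T\tau(v)\in D\}$, where $\tau:T^*Q\to Q$ is the projection, $\Omega_Q=-d\Theta_Q$ the canonical 2-form and $H$ the Hamiltonian of $L$. Let a Lie group $G$ (Lie algebra $\mathfrak g$) act smoothly, freely and properly on $Q$, preserving $L$ and $D$, and let $V$ be the tangent distribution to the $G$-orbits. Assume: * (dimension assumption) $T_qQ=D_q+V_q$ for all $q\in Q$; * (vertical symmetry condition) there are a distribution $W\subset V$ with $TQ=D\oplus W$ and a closed normal subgroup $G_W\subset G$ with $W_q=T_q(\mathrm{Orb}_{G_W}(q))$ for all $q$; * with $S=D\cap V$ of rank $k$, there are smooth $\zeta_1,\dots,\zeta_k:Q\to\mathfrak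 g$ with $(\zeta_i(q))_Q(q)\in S_q$ such that the functions $J_i=\mathbf i_{(\zeta_i)_{T^*Q}}\Theta_Q|_{\mathcal M}$ on $\mathcal M$ are $G$-invariant, conserved ($X_{\rm nh}(J_i)=0$), and functionally independent ($dJ_1,\dots,dJ_k$ are linearly independent at every point of $\mathcal M$). Let $\rho:Q\to\widetilde Q=Q/G_W$ and $\varrho:G\to F=G/G_W$ be the quotient manifold and the quotient Lie group, let $\mathfrak f$ be the Lie algebra of $F$, and let $F$ act on $\widetilde Q$ by $\varrho(g)\cdot\rho(q)=\rho(g\cdot q)$ and on $T^*\widetilde Q$ by cotangent lift. Let $\widetilde J:T^*\widetilde Q\to\mathfrak f^*$, $\langle\widetilde J(\alpha),\nu\rangle=(\mathbf i_{\nu_{T^*\widetilde Q}}\Theta_{\widetilde Q})(\alpha)$, be the canonical momentum map. Let $\eta_i:\widetilde Q\to\mathfrak f$ be given by $\eta_i(\rho(q))=T_e\varrho(\zeta_i(q))$, and let $\widetilde J_i(\alpha_x)=\langle\widetilde J(\alpha_x),\eta_i(x)\rangle$ for $\alpha_x\in T^*_x\widetilde Q$ be the partially reduced horizontal gauge momenta.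 Then the $\eta_i$ are well defined and form a basis of $\mathfrak f$ at each point of $\widetilde Q$. Let $\mu^1,\dots,\mu^k:\widetilde Q\to\mathfrak f^*$ be the dual basis, $\langle\mu^i(x),\eta_j(x)\rangle=\delta_{ij}$. For all $c_1,\dots,c_k\in\mathbb R$ and $\mu=\sum_i c_i\mu^i$, the set $\widetilde J^{-1}(\mu):=\{\alpha_x\in T^*\widetilde Q:\widetilde J(\alpha_x)=\mu(x)\}$ satisfies $$\widetilde J^{-1}(\mu)=\bigcap_{i=1}^k\widetilde J_i^{-1}(c_i),$$ and it is an $F$-invariant embedded submanifold of $T^*\widetilde Q$ of codimension $k$. Moreover, the connected components of the sets $\widetilde J^{-1}(\mu)$, for $\mu\in\operatorname{span}_{\mathbb R}\{\mu^1,\dots,\mu^k\}$, are the leaves of a smooth foliation of $T^*\widetilde Q$ of codimension $k$. -/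

import Mathlib

open scoped Manifold ContDiff Topology
open Bundle

noncomputable section

/-! ### Submanifolds, tangent vectors and foliations -/

/-- The vectors tangent to a subset `S` of a manifold at `x`: the velocities at time `0` of the
smooth curves `γ : (-ε, ε) → M` with values in `S` and `γ 0 = x`. For an embedded submanifold
this is its tangent space, seen inside the tangent space of `M`. -/
def tangentVectors {E H M : Type*} [NormedAddCommGroup E] [NormedSpace ℝ E] [TopologicalSpace H]
    (I : ModelWithCorners ℝ E H) [TopologicalSpace M] [ChartedSpace H M] (S : Set M) (x : M) :
    Set (TangentSpace I x) :=
  {v | ∃ (ε : ℝ) (γ : ℝ → M), 0 < ε ∧ γ 0 = x ∧ (∀ t ∈ Set.Ioo (-ε) ε, γ t ∈ S) ∧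
    ContMDiffOn 𝓘(ℝ, ℝ) I ∞ γ (Set.Ioo (-ε) ε) ∧
    (mfderiv 𝓘(ℝ, ℝ) I γ 0 : ℝ →L[ℝ] E) 1 = v}

/-- `S` is an embedded submanifold of codimension `k` of the manifold `M`: around each of its
points there is a chart of the smooth atlas in which `S` is a slice by an affine subspace of
codimension `k` (a fibre of a surjective linear map onto `ℝᵏ`). -/
def IsEmbeddedSubmanifold {E H M : Type*} [NormedAddCommGroup E] [NormedSpace ℝ E]
    [TopologicalSpace H] (I : ModelWithCorners ℝ E H) [TopologicalSpace M] [ChartedSpace H M]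
    (S : Set M) (k : ℕ) : Prop :=
  ∀ x ∈ S, ∃ φ ∈ IsManifold.maximalAtlas I ∞ M, x ∈ φ.source ∧
    ∃ p : E →L[ℝ] (Fin k → ℝ), Function.Surjective p ∧
      ∀ y ∈ φ.source, y ∈ S ↔ p (φ.extend I y) = p (φ.extend I x)

/-- The collection `ℱ` of subsets of `M` is (the set of leaves of) a smooth foliation of
codimension `k`: the leaves partition `M`, each leaf is path connected, and around every point
there is a flat chart, that is, a chart of the smooth atlas with convex image in which every leaf
is a (possibly empty) countable union of slices `{y | p y = c}`, where `p` is a fixed surjective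
linear map onto `ℝᵏ`. As a path in a countable union of slices stays in one slice of each flat
chart, path connectedness is the connectedness of the leaf as an immersed submanifold. -/
structure IsFoliation {E H M : Type*} [NormedAddCommGroup E] [NormedSpace ℝ E]
    [TopologicalSpace H] (I : ModelWithCorners ℝ E H) [TopologicalSpace M] [ChartedSpace H M]
    (ℱ : Set (Set M)) (k : ℕ) : Prop where
  partition : Setoid.IsPartition ℱ
  isPathConnected : ∀ L ∈ ℱ, IsPathConnected L
  flat_chart : ∀ x : M, ∃ φ ∈ IsManifold.maximalAtlas I ∞ M, x ∈ φ.source ∧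
    Convex ℝ (φ.extend I).target ∧
    ∃ p : E →L[ℝ] (Fin k → ℝ), Function.Surjective p ∧
      ∀ L ∈ ℱ, ∃ C : Set (Fin k → ℝ), C.Countable ∧
        ∀ y ∈ φ.source, y ∈ L ↔ p (φ.extend I y) ∈ C

/-- A smooth distribution of constant rank: near every point it is spanned by `r` smooth, pointwise
linearly independent vector fields. -/
def IsSmoothDistribution {E M : Type*} [NormedAddCommGroup E] [NormedSpace ℝ E]
    [TopologicalSpace M] [ChartedSpace E M] [IsManifold 𝓘(ℝ, E) ∞ M]
    (D : ∀ x : M, Submodule ℝ (TangentSpace 𝓘(ℝ, E) x)) : Prop :=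
  ∃ r : ℕ, ∀ x₀ : M, ∃ U : Set M, IsOpen U ∧ x₀ ∈ U ∧
    ∃ X : Fin r → ∀ x : M, TangentSpace 𝓘(ℝ, E) x,
      (∀ i, ContMDiffOn 𝓘(ℝ, E) 𝓘(ℝ, E).tangent ∞
        (fun x => (⟨x, X i x⟩ : TangentBundle 𝓘(ℝ, E) M)) U) ∧
      ∀ x ∈ U, LinearIndependent ℝ (fun i => X i x) ∧
        Submodule.span ℝ (Set.range fun i => X i x) = D x

/-! ### The cotangent bundle -/

/-- The cotangent bundle of a manifold modelled on the vector space `E`. -/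
abbrev CotangentBundle (E M : Type*) [NormedAddCommGroup E] [NormedSpace ℝ E]
    [TopologicalSpace M] [ChartedSpace E M] : Type _ :=
  TotalSpace (E →L[ℝ] ℝ) (fun x : M => TangentSpace 𝓘(ℝ, E) x →L[ℝ] Trivial M ℝ x)

/-- The model with corners (without boundary) of the cotangent bundle. -/
abbrev cotangentModel (E : Type*) [NormedAddCommGroup E] [NormedSpace ℝ E] :
    ModelWithCorners ℝ (E × (E →L[ℝ] ℝ)) (ModelProd E (E →L[ℝ] ℝ)) :=
  𝓘(ℝ, E).prod 𝓘(ℝ, E →L[ℝ] ℝ)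

section Cotangent

variable {E M : Type*} [NormedAddCommGroup E] [NormedSpace ℝ E]
  [TopologicalSpace M] [ChartedSpace E M] [IsManifold 𝓘(ℝ, E) ∞ M]

/-- The derivative of the projection `τ : T*M → M`. -/
def cotangentProjDeriv (α : CotangentBundle E M) :
    TangentSpace (cotangentModel E) α →L[ℝ] TangentSpace 𝓘(ℝ, E) α.proj :=
  mfderiv (cotangentModel E) 𝓘(ℝ, E) (fun β : CotangentBundle E M => β.proj) α

/-- The differential `df` at `α` of a real function `f` on `T*M`. -/
def cotangentDiff (f : CotangentBundle E M → ℝ) (α : CotangentBundle E M) :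
    TangentSpace (cotangentModel E) α →L[ℝ] ℝ :=
  mfderiv (cotangentModel E) 𝓘(ℝ, ℝ) f α

/-- The Liouville (canonical) 1-form `Θ` on `T*M`: `Θ_α(v) = α(Tτ v)`. -/
def liouvilleForm (α : CotangentBundle E M) : TangentSpace (cotangentModel E) α →L[ℝ] ℝ :=
  α.2 ∘L cotangentProjDeriv α

/-- The canonical 2-form `Ω = -dΘ` on `T*M`. In Mathlib the tangent space of `T*M` at `α` is
`E × E*`, through the preferred chart of `T*M` at `α`, which is the cotangent lift `(q, p)` of the
chart of `M` at `τ(α)`. In such coordinates `Ω = ∑ dqⁱ ∧ dpᵢ`. -/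
def canonicalTwoForm (α : CotangentBundle E M) (v w : TangentSpace (cotangentModel E) α) : ℝ :=
  let v' : E × (E →L[ℝ] ℝ) := v
  let w' : E × (E →L[ℝ] ℝ) := w
  w'.2 v'.1 - v'.2 w'.1

end Cotangent

/-! ### Group actions, cotangent lifts and momentum maps -/

section Action

variable {EG G : Type*} [NormedAddCommGroup EG] [NormedSpace ℝ EG] [TopologicalSpace G]
  [ChartedSpace EG G] [Group G]

/-- The infinitesimal generator `ξ ↦ ξ_X(x) = d/dt|₀ A (exp (t ξ)) x` of an action `A` of `G`
on `X`, i.e. the derivative at `1` of the orbit map `g ↦ A g x`. -/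
def infinitesimalGenerator {E H X : Type*} [NormedAddCommGroup E] [NormedSpace ℝ E]
    [TopologicalSpace H] (I : ModelWithCorners ℝ E H) [TopologicalSpace X] [ChartedSpace H X]
    (A : G → X → X) (x : X) : GroupLieAlgebra 𝓘(ℝ, EG) G →L[ℝ] TangentSpace I x :=
  -- the base point `A 1 x` of the derivative is `x`
  (mfderiv 𝓘(ℝ, EG) I (fun g => A g x) (1 : G) : EG →L[ℝ] E)

variable {E Q : Type*} [NormedAddCommGroup E] [NormedSpace ℝ E]
  [TopologicalSpace Q] [ChartedSpace E Q] [IsManifold 𝓘(ℝ, E) ∞ Q] [MulAction G Q]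

/-- The generator `ξ ↦ ξ_Q(q)` of the action of `G` on the configuration manifold `Q`. -/
def generator (q : Q) : GroupLieAlgebra 𝓘(ℝ, EG) G →L[ℝ] TangentSpace 𝓘(ℝ, E) q :=
  infinitesimalGenerator 𝓘(ℝ, E) (fun (g : G) (x : Q) => g • x) q

/-- The vertical space `V_q`, tangent at `q` to the `G`-orbit of `q`. -/
def verticalSpace (EG G : Type*) [NormedAddCommGroup EG] [NormedSpace ℝ EG] [TopologicalSpace G]
    [ChartedSpace EG G] [Group G] [MulAction G Q] (q : Q) :
    Submodule ℝ (TangentSpace 𝓘(ℝ, E) q) :=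
  LinearMap.range (generator (EG := EG) (G := G) q).toLinearMap

/-- The cotangent lift of the action: `g · α = α ∘ (T_q Ψ_g)⁻¹ ∈ T*_{gq} Q` for `α ∈ T*_q Q`. -/
def cotangentLift (g : G) (α : CotangentBundle E Q) : CotangentBundle E Q :=
  ⟨g • α.proj, α.2 ∘L (mfderiv 𝓘(ℝ, E) 𝓘(ℝ, E) (fun x : Q => g • x) α.proj).inverse⟩

/-- The canonical momentum map `⟨J(α), ν⟩ = (i_{ν_{T*Q}} Θ)(α)` of the cotangent lifted action. -/
def momentumMap (α : CotangentBundle E Q) : Module.Dual ℝ (GroupLieAlgebra 𝓘(ℝ, EG) G) :=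
  (liouvilleForm α ∘L infinitesimalGenerator (cotangentModel E)
    (fun (g : G) (β : CotangentBundle E Q) => cotangentLift g β) α).toLinearMap

/-- The function `J_ξ(α) = ⟨J(α), ξ(q)⟩ = (i_{ξ_{T*Q}} Θ)(α)`, `α ∈ T*_q Q`, attached to a
Lie algebra valued function `ξ` on `Q`. -/
def gaugeMomentum (ξ : Q → GroupLieAlgebra 𝓘(ℝ, EG) G) (α : CotangentBundle E Q) : ℝ :=
  momentumMap α (ξ α.proj)

/-- The set `{α ∈ T*_x Q | J(α) = μ(x)}` for a function `μ` with values in the dual of the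
Lie algebra. -/
def momentumLevelSet (μ : Q → Module.Dual ℝ (GroupLieAlgebra 𝓘(ℝ, EG) G)) :
    Set (CotangentBundle E Q) :=
  {α | momentumMap α = μ α.proj}

end Action

/-- The dual frame `μ¹, …, μᵏ` of a frame `η₁, …, ηₖ` of vector-valued functions:
`⟨μⁱ(x), η_j(x)⟩ = δᵢⱼ` (and `0` at the points where the `ηⱼ(x)` are not a basis). -/
def dualFrame {X V : Type*} [AddCommGroup V] [Module ℝ V] {k : ℕ} (η : Fin k → X → V)
    (i : Fin k) (x : X) : Module.Dual ℝ V :=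
  open Classical in
  if h : LinearIndependent ℝ (fun j => η j x) ∧
      ⊤ ≤ Submodule.span ℝ (Set.range fun j => η j x) then
    (Module.Basis.mk h.1 h.2).coord i
  else 0

/-! ### Nonholonomic systems with symmetries -/

/-- A nonholonomic system of mechanical type on `Q`: kinetic energy metric `κ`, potential `U` and
constraint distribution `D`. -/
structure NonholonomicSystem (E Q : Type*) [NormedAddCommGroup E] [NormedSpace ℝ E]
    [TopologicalSpace Q] [ChartedSpace E Q] [IsManifold 𝓘(ℝ, E) ∞ Q] where
  κ : ContMDiffRiemannianMetric 𝓘(ℝ, E) ∞ E (fun q : Q => TangentSpace 𝓘(ℝ, E) q)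
  U : Q → ℝ
  contMDiff_U : ContMDiff 𝓘(ℝ, E) 𝓘(ℝ, ℝ) ∞ U
  D : ∀ q : Q, Submodule ℝ (TangentSpace 𝓘(ℝ, E) q)
  isSmoothDistribution_D : IsSmoothDistribution D

namespace NonholonomicSystem

variable {E Q : Type*} [NormedAddCommGroup E] [NormedSpace ℝ E]
  [TopologicalSpace Q] [ChartedSpace E Q] [IsManifold 𝓘(ℝ, E) ∞ Q]

/-- The Lagrangian `L(v) = κ(v, v) / 2 - U`. -/
def lagrangian (𝒩 : NonholonomicSystem E Q) (v : TangentBundle 𝓘(ℝ, E) Q) : ℝ :=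
  (1 / 2) * 𝒩.κ.inner v.proj v.2 v.2 - 𝒩.U v.proj

/-- The Legendre transformation `TQ → T*Q`, `v ↦ κ(v, ·)`. -/
def legendre (𝒩 : NonholonomicSystem E Q) (v : TangentBundle 𝓘(ℝ, E) Q) :
    CotangentBundle E Q :=
  ⟨v.proj, 𝒩.κ.inner v.proj v.2⟩

/-- The Hamiltonian of the Lagrangian: `H(α) = α(u) / 2 + U` for the `u` with `κ(u, ·) = α`. -/
def hamiltonian (𝒩 : NonholonomicSystem E Q) (α : CotangentBundle E Q) : ℝ :=
  (1 / 2) * (α.2 ((𝒩.κ.inner α.proj).inverse α.2) : ℝ) + 𝒩.U α.proj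

/-- The constraint submanifold `ℳ` of `T*Q`, the image of `D` under the Legendre
transformation. -/
def constraintManifold (𝒩 : NonholonomicSystem E Q) : Set (CotangentBundle E Q) :=
  𝒩.legendre '' {v | v.2 ∈ 𝒩.D v.proj}

/-- The distribution `𝒞` on `ℳ`: the vectors tangent to `ℳ` that project into `D`. -/
def constraintVectors (𝒩 : NonholonomicSystem E Q) (m : CotangentBundle E Q) :
    Set (TangentSpace (cotangentModel E) m) :=
  {v | v ∈ tangentVectors (cotangentModel E) 𝒩.constraintManifold m ∧
    cotangentProjDeriv m v ∈ 𝒩.D m.proj}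

/-- `v` is the value at `m` of the nonholonomic vector field: `v ∈ 𝒞_m` and
`i_v Ω = dH` on `𝒞_m`. -/
def IsNonholonomicVector (𝒩 : NonholonomicSystem E Q) (m : CotangentBundle E Q)
    (v : TangentSpace (cotangentModel E) m) : Prop :=
  v ∈ 𝒩.constraintVectors m ∧ ∀ w ∈ 𝒩.constraintVectors m,
    canonicalTwoForm m v w = cotangentDiff 𝒩.hamiltonian m w

/-- The restriction to `ℳ` of the smooth function `f` on `T*Q` is conserved: `X_nh(f) = 0`. -/
def IsConserved (𝒩 : NonholonomicSystem E Q) (f : CotangentBundle E Q → ℝ) : Prop :=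
  ∀ m ∈ 𝒩.constraintManifold, ∀ v : TangentSpace (cotangentModel E) m,
    𝒩.IsNonholonomicVector m v → cotangentDiff f m v = 0

/-- The action of `G` is a symmetry: its tangent lift preserves the Lagrangian and `D`. -/
def IsSymmetry (𝒩 : NonholonomicSystem E Q) (G : Type*) [Group G] [MulAction G Q] : Prop :=
  ∀ g : G, (∀ v : TangentBundle 𝓘(ℝ, E) Q,
      𝒩.lagrangian (tangentMap 𝓘(ℝ, E) 𝓘(ℝ, E) (fun q : Q => g • q) v) = 𝒩.lagrangian v) ∧
    ∀ q : Q, ∀ v ∈ 𝒩.D q,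
      mfderiv 𝓘(ℝ, E) 𝓘(ℝ, E) (fun q : Q => g • q) q v ∈ 𝒩.D (g • q)

/-- The dimension assumption `T_q Q = D_q + V_q`. -/
def DimensionAssumption (𝒩 : NonholonomicSystem E Q) (EG G : Type*) [NormedAddCommGroup EG]
    [NormedSpace ℝ EG] [TopologicalSpace G] [ChartedSpace EG G] [Group G] [MulAction G Q] : Prop :=
  ∀ q : Q, 𝒩.D q ⊔ verticalSpace EG G q = ⊤

/-- `W` is a vertical complement of the constraints (`TQ = D ⊕ W`, `W ⊆ V`) that satisfies the
vertical symmetry condition with the closed normal subgroup `G_W`: `W_q` is the tangent space at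
`q` of the `G_W`-orbit of `q`. -/
structure VerticalSymmetryCondition (𝒩 : NonholonomicSystem E Q) (EG : Type*) {G : Type*}
    [NormedAddCommGroup EG] [NormedSpace ℝ EG] [TopologicalSpace G] [ChartedSpace EG G] [Group G]
    [MulAction G Q] (W : ∀ q : Q, Submodule ℝ (TangentSpace 𝓘(ℝ, E) q)) (GW : Subgroup G) :
    Prop where
  isCompl : ∀ q, IsCompl (𝒩.D q) (W q)
  le_vertical : ∀ q, W q ≤ verticalSpace EG G q
  isClosed : IsClosed (GW : Set G)
  normal : GW.Normal
  eq_tangent : ∀ q, (W q : Set (TangentSpace 𝓘(ℝ, E) q)) =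
    tangentVectors 𝓘(ℝ, E) (MulAction.orbit GW q) q

/-- `ζ₁, …, ζₖ` are smooth sections of `𝔤_S` (where `S = D ∩ V` has rank `k`) such that the
functions `Jᵢ = J_{ζᵢ}` on `ℳ` are `G`-invariant, functionally independent horizontal gauge
momenta. -/
structure IsHorizontalGaugeSymmetryBasis (𝒩 : NonholonomicSystem E Q) {EG G : Type*}
    [NormedAddCommGroup EG] [NormedSpace ℝ EG] [TopologicalSpace G] [ChartedSpace EG G] [Group G]
    [MulAction G Q] {k : ℕ} (ζ : Fin k → Q → GroupLieAlgebra 𝓘(ℝ, EG) G) : Prop where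
  rank_eq : ∀ q : Q, Module.finrank ℝ ↥(𝒩.D q ⊓ verticalSpace EG G q) = k
  contMDiff : ∀ i, ContMDiff (M' := EG) 𝓘(ℝ, E) 𝓘(ℝ, EG) ∞ (ζ i)
  mem : ∀ i q, generator q (ζ i q) ∈ 𝒩.D q ⊓ verticalSpace EG G q
  conserved : ∀ i, 𝒩.IsConserved (gaugeMomentum (ζ i))
  invariant : ∀ i, ∀ g : G, ∀ m ∈ 𝒩.constraintManifold,
    gaugeMomentum (ζ i) (cotangentLift g m) = gaugeMomentum (ζ i) m
  independent : ∀ m ∈ 𝒩.constraintManifold, ∀ a : Fin k → ℝ,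
    (∀ v ∈ tangentVectors (cotangentModel E) 𝒩.constraintManifold m,
      ∑ i, a i * cotangentDiff (gaugeMomentum (ζ i)) m v = 0) →
    a = 0

end NonholonomicSystem

/-! ### Reduction by the normal subgroup -/

/-- `ρ : Q → Q'` and `pr : G → F` exhibit the manifold `Q'` as the orbit manifold `Q / G_W` and the
Lie group `F` as the quotient `G / G_W`, each with its quotient smooth structure (the projection
is a submersion), and the `F`-action on `Q'` is the one induced by the `G`-action on `Q`. -/
structure IsReduction {EG G E Q EF F E' Q' : Type*}
    [NormedAddCommGroup EG] [NormedSpace ℝ EG] [TopologicalSpace G] [ChartedSpace EG G] [Group G]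
    [NormedAddCommGroup E] [NormedSpace ℝ E] [TopologicalSpace Q] [ChartedSpace E Q]
    [NormedAddCommGroup EF] [NormedSpace ℝ EF] [TopologicalSpace F] [ChartedSpace EF F] [Group F]
    [NormedAddCommGroup E'] [NormedSpace ℝ E'] [TopologicalSpace Q'] [ChartedSpace E' Q']
    [MulAction G Q] [MulAction F Q'] (GW : Subgroup G) (ρ : Q → Q') (pr : G →* F) : Prop where
  isSubmersion_base : Manifold.IsSubmersion 𝓘(ℝ, E) 𝓘(ℝ, E') ∞ ρ
  surjective_base : Function.Surjective ρ
  base_eq_iff : ∀ q₁ q₂ : Q, ρ q₁ = ρ q₂ ↔ q₁ ∈ MulAction.orbit GW q₂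
  isSubmersion_group : Manifold.IsSubmersion 𝓘(ℝ, EG) 𝓘(ℝ, EF) ∞ pr
  surjective_group : Function.Surjective pr
  ker_eq : pr.ker = GW
  equivariant : ∀ (g : G) (q : Q), ρ (g • q) = pr g • ρ q

/-- The Lie algebra homomorphism `T_1 pr : 𝔤 → 𝔣` of a homomorphism `pr` of Lie groups. -/
def lieProjection {EG G EF F : Type*} [NormedAddCommGroup EG] [NormedSpace ℝ EG]
    [TopologicalSpace G] [ChartedSpace EG G] [Group G] [NormedAddCommGroup EF] [NormedSpace ℝ EF]
    [TopologicalSpace F] [ChartedSpace EF F] [Group F] (pr : G →* F) :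
    GroupLieAlgebra 𝓘(ℝ, EG) G →L[ℝ] GroupLieAlgebra 𝓘(ℝ, EF) F :=
  -- the base point `pr 1` of the derivative is `1`
  (mfderiv 𝓘(ℝ, EG) 𝓘(ℝ, EF) pr (1 : G) : EG →L[ℝ] EF)

/-- The `𝔣`-valued function `η` on `Q' = Q / G_W` induced by the `𝔤`-valued function `ζ` on `Q`:
`η(x) = T_1 pr (ζ(q))` for a point `q` over `x`. -/
def reducedSymmetry {EG G Q EF F Q' : Type*} [NormedAddCommGroup EG] [NormedSpace ℝ EG]
    [TopologicalSpace G] [ChartedSpace EG G] [Group G] [NormedAddCommGroup EF] [NormedSpace ℝ EF]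
    [TopologicalSpace F] [ChartedSpace EF F] [Group F] (pr : G →* F) {ρ : Q → Q'}
    (hρ : Function.Surjective ρ) (ζ : Q → GroupLieAlgebra 𝓘(ℝ, EG) G) (x : Q') :
    GroupLieAlgebra 𝓘(ℝ, EF) F :=
  lieProjection pr (ζ (Function.surjInv hρ x))

end

/-! The function `J_i` on `ℳ = κ♯(D)` is the `κ`-pairing with the generator `Zᵢ(q) = (ζᵢ(q))_Q(q)`.
Independence of the `dJ_i` at the zero covectors makes the `Zᵢ` a frame of `S = D ∩ V`, and this
frame is `G`-invariant because the `J_i`, `κ` and `D` are and `κ` is positive definite on `D`. The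
kernel `W` of `Tρ` is a complement of `S` in `V`, so the `Zᵢ` project to the generators of the `ηᵢ`,
which form an `F`-invariant frame of the vertical distribution of `Q'`. As `F` acts freely, a
generator determines its Lie algebra element, and the `ηᵢ(x)` are a basis of `𝔣`.

Hence `J̃ = Σ cᵢ μⁱ` says exactly that `J̃_i = cᵢ` for all `i`. Along a fibre of `T*Q'` the map
`(J̃₁, …, J̃ₖ)` is the pairing with `k` independent vectors, so it is a submersion to `ℝᵏ`: its
fibres are the level sets, and charts in which it is linear are flat charts for the components. -/

/-! ### Tangent vectors and submersions -/

section TangentVectors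

variable {E H M E' H' N : Type*} [NormedAddCommGroup E] [NormedSpace ℝ E] [TopologicalSpace H]
  {I : ModelWithCorners ℝ E H} [TopologicalSpace M] [ChartedSpace H M]
  [NormedAddCommGroup E'] [NormedSpace ℝ E'] [TopologicalSpace H']
  {I' : ModelWithCorners ℝ E' H'} [TopologicalSpace N] [ChartedSpace H' N]

/-- The base points `y₁` and `y₂` are kept apart from `f₁ x` and `f₂ x`, to which they are often
equal only propositionally: this is why the equality is stated in the model space. -/
theorem mfderiv_mfderiv_eq_of_comp_eventuallyEq {E₁ H₁ M₁ E₂ H₂ M₂ : Type*}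
    [NormedAddCommGroup E₁] [NormedSpace ℝ E₁] [TopologicalSpace H₁]
    {I₁ : ModelWithCorners ℝ E₁ H₁} [TopologicalSpace M₁] [ChartedSpace H₁ M₁]
    [NormedAddCommGroup E₂] [NormedSpace ℝ E₂] [TopologicalSpace H₂]
    {I₂ : ModelWithCorners ℝ E₂ H₂} [TopologicalSpace M₂] [ChartedSpace H₂ M₂]
    {f₁ : M → M₁} {g₁ : M₁ → N} {f₂ : M → M₂} {g₂ : M₂ → N} {x : M} {y₁ : M₁} {y₂ : M₂}
    (hg₁ : MDifferentiableAt I₁ I' g₁ y₁) (hf₁ : MDifferentiableAt I I₁ f₁ x) (h₁ : f₁ x = y₁)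
    (hg₂ : MDifferentiableAt I₂ I' g₂ y₂) (hf₂ : MDifferentiableAt I I₂ f₂ x) (h₂ : f₂ x = y₂)
    (h : g₁ ∘ f₁ =ᶠ[𝓝 x] g₂ ∘ f₂) (v : TangentSpace I x) :
    (mfderiv I₁ I' g₁ y₁ : E₁ →L[ℝ] E') (mfderiv I I₁ f₁ x v) =
      (mfderiv I₂ I' g₂ y₂ : E₂ →L[ℝ] E') (mfderiv I I₂ f₂ x v) := by
  subst h₁ h₂
  exact DFunLike.congr_fun (hasMFDerivAt_unique
    ((hg₁.hasMFDerivAt.comp x hf₁.hasMFDerivAt).congr_of_eventuallyEq h.symm)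
    (hg₂.hasMFDerivAt.comp x hf₂.hasMFDerivAt)) v

theorem mfderiv_mfderiv_eq_self {f : M → N} {g : N → M} {x : M} {y : N}
    (hg : MDifferentiableAt I' I g y) (hf : MDifferentiableAt I I' f x) (hy : f x = y)
    (h : g ∘ f =ᶠ[𝓝 x] id) (v : TangentSpace I x) :
    (mfderiv I' I g y : E' →L[ℝ] E) (mfderiv I I' f x v) = v := by
  subst hy
  exact DFunLike.congr_fun (hasMFDerivAt_unique
    ((hg.hasMFDerivAt.comp x hf.hasMFDerivAt).congr_of_eventuallyEq h.symm) (hasMFDerivAt_id x)) v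

theorem mfderiv_apply_eq_of_mem_tangentVectors {S : Set M} {x : M} {v : TangentSpace I x}
    (hv : v ∈ tangentVectors I S x) {f g : M → N} (hf : MDifferentiableAt I I' f x)
    (hg : MDifferentiableAt I I' g x) (hfg : Set.EqOn f g S) :
    (mfderiv I I' f x v : E') = mfderiv I I' g x v := by
  obtain ⟨ε, γ, hε, rfl, hS, hγ, rfl⟩ := hv
  have hε0 : Set.Ioo (-ε) ε ∈ 𝓝 (0 : ℝ) := Ioo_mem_nhds (neg_neg_of_pos hε) hε
  have hγ0 : MDifferentiableAt 𝓘(ℝ, ℝ) I γ 0 :=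
    (hγ.contMDiffAt hε0).mdifferentiableAt (by simp)
  refine mfderiv_mfderiv_eq_of_comp_eventuallyEq hf hγ0 rfl hg hγ0 rfl ?_ (1 : ℝ)
  filter_upwards [hε0] with t ht using hfg (hS t ht)

theorem mem_tangentVectors_of_isOpen {S : Set M} {x : M} {v : TangentSpace I x} {γ : ℝ → M}
    {T : Set ℝ} (hT : IsOpen T) (h0T : 0 ∈ T) (h0 : γ 0 = x) (hγ : ContMDiffOn 𝓘(ℝ, ℝ) I ∞ γ T)
    (hS : Set.MapsTo γ T S) (hv : (mfderiv 𝓘(ℝ, ℝ) I γ 0 : ℝ →L[ℝ] E) 1 = v) :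
    v ∈ tangentVectors I S x := by
  obtain ⟨ε, hε, hball⟩ := Metric.isOpen_iff.1 hT 0 h0T
  rw [Real.ball_eq_Ioo, zero_sub, zero_add] at hball
  exact ⟨ε, γ, hε, h0, fun t ht => hS (hball ht), hγ.mono hball, hv⟩

end TangentVectors

section Submersion

variable {E M E' N : Type*} [NormedAddCommGroup E] [NormedSpace ℝ E]
  [TopologicalSpace M] [ChartedSpace E M]
  [NormedAddCommGroup E'] [NormedSpace ℝ E']
  [TopologicalSpace N] [ChartedSpace E' N]

theorem tangentVectors_univ [IsManifold 𝓘(ℝ, E) ∞ M] (x : M) :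
    tangentVectors 𝓘(ℝ, E) (Set.univ : Set M) x = Set.univ := by
  refine Set.eq_univ_of_forall fun v => ?_
  set φ := chartAt E x
  let w : E := mfderiv 𝓘(ℝ, E) 𝓘(ℝ, E) φ x v
  have hφ : φ ∈ IsManifold.maximalAtlas 𝓘(ℝ, E) ∞ M := IsManifold.chart_mem_maximalAtlas x
  have hx : x ∈ φ.source := mem_chart_source E x
  have hline : ContDiff ℝ ∞ fun t : ℝ => φ x + t • w := by fun_prop
  have h0 : φ x + (0 : ℝ) • w = φ x := by rw [zero_smul, add_zero]
  have hφx : MDifferentiableAt 𝓘(ℝ, E) 𝓘(ℝ, E) φ x :=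
    (contMDiffAt_of_mem_maximalAtlas hφ hx).mdifferentiableAt (by simp)
  have hφs : MDifferentiableAt 𝓘(ℝ, E) 𝓘(ℝ, E) φ.symm (φ x) :=
    (contMDiffAt_symm_of_mem_maximalAtlas hφ (φ.map_source hx)).mdifferentiableAt (by simp)
  refine mem_tangentVectors_of_isOpen (φ.open_target.preimage hline.continuous)
    (γ := fun t : ℝ => φ.symm (φ x + t • w)) ?_ ?_ ?_ (Set.mapsTo_univ _ _) ?_
  · simpa only [Set.mem_preimage, h0] using φ.map_source hx
  · simpa only [h0] using φ.left_inv hx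
  · exact (contMDiffOn_symm_of_mem_maximalAtlas hφ).comp hline.contMDiff.contMDiffOn fun _ h => h
  · have hw : (mfderiv 𝓘(ℝ, ℝ) 𝓘(ℝ, E) (fun t : ℝ => φ x + t • w) 0 : ℝ →L[ℝ] E) 1 = w := by
      rw [mfderiv_eq_fderiv, fderiv_const_add, fderiv_smul_const (by fun_prop), fderiv_fun_id]
      exact one_smul ℝ w
    have hv := mfderiv_mfderiv_eq_self hφs hφx rfl
      (Filter.eventually_of_mem (φ.open_source.mem_nhds hx) fun y hy => φ.left_inv hy) v
    refine (mfderiv_comp_apply_of_eq (x := (0 : ℝ)) (f := fun t : ℝ => φ x + t • w) hφs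
      (hline.contMDiff.mdifferentiableAt (by simp)) h0 (1 : ℝ)).trans ?_
    exact (congrArg _ hw).trans hv

theorem exists_contMDiffOn_lift [IsManifold 𝓘(ℝ, E) ∞ M] [IsManifold 𝓘(ℝ, E') ∞ N]
    {f : M → N} {x : M} (h : Manifold.IsSubmersionAt 𝓘(ℝ, E) 𝓘(ℝ, E') ∞ f x) :
    ∃ (O : Set (N × M)) (T : N × M → M), IsOpen O ∧ (f x, x) ∈ O ∧
      ContMDiffOn (𝓘(ℝ, E').prod 𝓘(ℝ, E)) 𝓘(ℝ, E) ∞ T O ∧ (∀ p ∈ O, f (T p) = p.1) ∧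
      ∀ z, (f z, z) ∈ O → T (f z, z) = z := by
  set φ := h.domChart
  set ψ := h.codChart
  set e := h.equiv
  have hφ := h.domChart_mem_maximalAtlas
  have hψf : ∀ z ∈ φ.source, ψ (f z) = (e (φ z)).1 := fun z hz => by
    have h' : ψ (f (φ.symm (φ z))) = (e (φ z)).1 :=
      h.writtenInCharts ((φ.extend 𝓘(ℝ, E)).map_source (x := z) (by simpa using hz))
    rwa [φ.left_inv hz] at h'
  let A : N × M → E := fun p => e.symm (ψ p.1, (e (φ p.2)).2)
  have hA : ContMDiffOn (𝓘(ℝ, E').prod 𝓘(ℝ, E)) 𝓘(ℝ, E) ∞ A (ψ.source ×ˢ φ.source) := by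
    refine e.symm.contDiff.contMDiff.comp_contMDiffOn (ContMDiffOn.prodMk_space ?_ ?_)
    · exact (contMDiffOn_of_mem_maximalAtlas h.codChart_mem_maximalAtlas).comp
        contMDiffOn_fst fun p hp => hp.1
    · exact ((contDiff_snd.comp e.contDiff).contMDiff.comp_contMDiffOn
        (contMDiffOn_of_mem_maximalAtlas hφ)).comp contMDiffOn_snd fun p hp => hp.2
  have hA_graph : ∀ z ∈ φ.source, A (f z, z) = φ z := fun z hz => by
    simp only [A, hψf z hz, Prod.mk.eta, e.symm_apply_apply]
  refine ⟨ψ.source ×ˢ φ.source ∩ A ⁻¹' φ.target, φ.symm ∘ A,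
    hA.continuousOn.isOpen_inter_preimage (ψ.open_source.prod φ.open_source) φ.open_target,
    ⟨⟨h.mem_codChart_source, h.mem_domChart_source⟩, ?_⟩,
    (contMDiffOn_symm_of_mem_maximalAtlas hφ).comp (hA.mono Set.inter_subset_left)
      fun p hp => hp.2, ?_, ?_⟩
  · rw [Set.mem_preimage, hA_graph x h.mem_domChart_source]
    exact φ.map_source h.mem_domChart_source
  · rintro p ⟨⟨hp, -⟩, hAp⟩
    refine ψ.injOn (h.source_subset_preimage_source (φ.map_target hAp)) hp ?_
    rw [hψf _ (φ.map_target hAp), φ.right_inv hAp, e.apply_symm_apply]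
  · rintro z ⟨⟨-, hz⟩, -⟩
    rw [Function.comp_apply, hA_graph z hz, φ.left_inv hz]

theorem exists_contMDiffAt_section [IsManifold 𝓘(ℝ, E) ∞ M] [IsManifold 𝓘(ℝ, E') ∞ N]
    {f : M → N} {x : M} (h : Manifold.IsSubmersionAt 𝓘(ℝ, E) 𝓘(ℝ, E') ∞ f x) :
    ∃ σ : N → M, ContMDiffAt 𝓘(ℝ, E') 𝓘(ℝ, E) ∞ σ (f x) ∧ σ (f x) = x ∧
      ∀ᶠ y in 𝓝 (f x), f (σ y) = y := by
  obtain ⟨O, T, hO, hxO, hT, hfT, hTf⟩ := exists_contMDiffOn_lift h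
  refine ⟨fun y => T (y, x), ?_, hTf x hxO, ?_⟩
  · exact (hT.contMDiffAt (hO.mem_nhds hxO)).comp (f x) (f := fun y => (y, x))
      (contMDiffAt_id.prodMk contMDiffAt_const)
  · filter_upwards [(Continuous.prodMk_left x).continuousAt.preimage_mem_nhds
      (hO.mem_nhds hxO)] with y hy using hfT _ hy

theorem mem_tangentVectors_fiber [IsManifold 𝓘(ℝ, E) ∞ M] [IsManifold 𝓘(ℝ, E') ∞ N]
    {f : M → N} {x : M} (h : Manifold.IsSubmersionAt 𝓘(ℝ, E) 𝓘(ℝ, E') ∞ f x)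
    {v : TangentSpace 𝓘(ℝ, E) x} (hv : mfderiv 𝓘(ℝ, E) 𝓘(ℝ, E') f x v = 0) :
    v ∈ tangentVectors 𝓘(ℝ, E) (f ⁻¹' {f x}) x := by
  obtain ⟨O, T, hO, hxO, hT, hfT, hTf⟩ := exists_contMDiffOn_lift h
  obtain ⟨ε, c, hε, rfl, -, hc, hcv⟩ :=
    (tangentVectors_univ (E := E) x).ge (Set.mem_univ v)
  have hε0 : (0 : ℝ) ∈ Set.Ioo (-ε) ε := ⟨neg_neg_of_pos hε, hε⟩
  have hpair : ContMDiffOn 𝓘(ℝ, ℝ) (𝓘(ℝ, E').prod 𝓘(ℝ, E)) ∞ (fun t => (f (c 0), c t))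
      (Set.Ioo (-ε) ε) := contMDiffOn_const.prodMk hc
  refine mem_tangentVectors_of_isOpen (γ := fun t => T (f (c 0), c t))
    (hpair.continuousOn.isOpen_inter_preimage isOpen_Ioo hO) ⟨hε0, hxO⟩ (hTf _ hxO)
    (hT.comp (hpair.mono Set.inter_subset_left) fun t ht => ht.2) (fun t ht => hfT _ ht.2) ?_
  have hTd : MDifferentiableAt (𝓘(ℝ, E').prod 𝓘(ℝ, E)) 𝓘(ℝ, E) T (f (c 0), c 0) :=
    (hT.contMDiffAt (hO.mem_nhds hxO)).mdifferentiableAt (by simp)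
  have hcd : MDifferentiableAt 𝓘(ℝ, ℝ) 𝓘(ℝ, E) c 0 :=
    (hc.contMDiffAt (Ioo_mem_nhds hε0.1 hε0.2)).mdifferentiableAt (by simp)
  have hfd : MDifferentiableAt 𝓘(ℝ, E) 𝓘(ℝ, E') f (c 0) :=
    h.contMDiffAt.mdifferentiableAt (by simp)
  have hgraph : MDifferentiableAt 𝓘(ℝ, E) (𝓘(ℝ, E').prod 𝓘(ℝ, E)) (fun z => (f z, id z)) (c 0) :=
    hfd.prodMk mdifferentiableAt_id
  have hid : T ∘ (fun z => (f z, id z)) =ᶠ[𝓝 (c 0)] id := by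
    filter_upwards [hgraph.continuousAt.preimage_mem_nhds (hO.mem_nhds hxO)] with z hz
      using hTf z hz
  have hγ : (mfderiv 𝓘(ℝ, ℝ) 𝓘(ℝ, E) (fun t => T (f (c 0), c t)) 0 : ℝ →L[ℝ] E) 1 =
      (mfderiv (𝓘(ℝ, E').prod 𝓘(ℝ, E)) 𝓘(ℝ, E) T (f (c 0), c 0) : E' × E →L[ℝ] E) (0, v) := by
    refine (mfderiv_comp_apply (0 : ℝ) (g := T) (f := fun t => (f (c 0), c t)) hTd
      (mdifferentiableAt_const.prodMk hcd) (1 : ℝ)).trans ?_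
    rw [mfderiv_prodMk mdifferentiableAt_const hcd, mfderiv_const]
    exact congrArg _ (Prod.ext rfl hcv)
  have hgv : (mfderiv 𝓘(ℝ, E) (𝓘(ℝ, E').prod 𝓘(ℝ, E)) (fun z => (f z, id z)) (c 0) v : E' × E) =
      (0, v) := by
    rw [mfderiv_prodMk hfd mdifferentiableAt_id, mfderiv_id]
    exact Prod.ext hv rfl
  exact hγ.trans ((congrArg _ hgv.symm).trans (mfderiv_mfderiv_eq_self hTd hgraph rfl hid v))

end Submersion

/-! ### Infinitesimal generators of free actions -/

section Action

variable {EG G E Q : Type*}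
  [NormedAddCommGroup EG] [NormedSpace ℝ EG] [TopologicalSpace G] [ChartedSpace EG G]
  [NormedAddCommGroup E] [NormedSpace ℝ E] [TopologicalSpace Q] [ChartedSpace E Q]

variable (EG E) in
theorem contMDiff_smul_const [SMul G Q] [ContMDiffSMul 𝓘(ℝ, EG) 𝓘(ℝ, E) ∞ G Q] (q : Q) :
    ContMDiff 𝓘(ℝ, EG) 𝓘(ℝ, E) ∞ fun g : G => g • q :=
  contMDiff_id.smul contMDiff_const

variable (EG E) in
theorem mdifferentiableAt_smul_const [SMul G Q] [ContMDiffSMul 𝓘(ℝ, EG) 𝓘(ℝ, E) ∞ G Q] (q : Q)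
    (g : G) : MDifferentiableAt 𝓘(ℝ, EG) 𝓘(ℝ, E) (fun g : G => g • q) g :=
  (contMDiff_smul_const EG E q).mdifferentiableAt (by simp)

variable [Group G] [MulAction G Q]

variable (EG) in
theorem mdifferentiableAt_const_smul [ContMDiffSMul 𝓘(ℝ, EG) 𝓘(ℝ, E) ∞ G Q] (g : G) (q : Q) :
    MDifferentiableAt 𝓘(ℝ, E) 𝓘(ℝ, E) (fun x : Q => g • x) q :=
  (ContMDiffSMul.contMDiff_const_smul (n := ∞) (I := 𝓘(ℝ, EG)) g).mdifferentiableAt (by simp)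

variable (EG) in
theorem mfderiv_smul_mfderiv_inv_smul [ContMDiffSMul 𝓘(ℝ, EG) 𝓘(ℝ, E) ∞ G Q] (g : G) (q : Q)
    (v : TangentSpace 𝓘(ℝ, E) (g • q)) :
    (mfderiv 𝓘(ℝ, E) 𝓘(ℝ, E) (fun x : Q => g • x) q : E →L[ℝ] E)
      (mfderiv 𝓘(ℝ, E) 𝓘(ℝ, E) (fun x : Q => g⁻¹ • x) (g • q) v) = v :=
  mfderiv_mfderiv_eq_self (mdifferentiableAt_const_smul EG g q)
    (mdifferentiableAt_const_smul EG g⁻¹ (g • q)) (inv_smul_smul g q)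
    (.of_forall (smul_inv_smul g)) v

variable (EG) in
theorem mfderiv_inv_smul_mfderiv_smul [ContMDiffSMul 𝓘(ℝ, EG) 𝓘(ℝ, E) ∞ G Q] (g : G) (q : Q)
    (v : TangentSpace 𝓘(ℝ, E) q) :
    (mfderiv 𝓘(ℝ, E) 𝓘(ℝ, E) (fun x : Q => g⁻¹ • x) (g • q) : E →L[ℝ] E)
      (mfderiv 𝓘(ℝ, E) 𝓘(ℝ, E) (fun x : Q => g • x) q v) = v :=
  mfderiv_mfderiv_eq_self (mdifferentiableAt_const_smul EG g⁻¹ (g • q))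
    (mdifferentiableAt_const_smul EG g q) rfl (.of_forall (inv_smul_smul g)) v

variable (EG) in
theorem mfderiv_smul_inverse [ContMDiffSMul 𝓘(ℝ, EG) 𝓘(ℝ, E) ∞ G Q] (g : G) (q : Q) :
    ((mfderiv 𝓘(ℝ, E) 𝓘(ℝ, E) (fun x : Q => g • x) q).inverse : E →L[ℝ] E) =
      (mfderiv 𝓘(ℝ, E) 𝓘(ℝ, E) (fun x : Q => g⁻¹ • x) (g • q) : E →L[ℝ] E) :=
  ContinuousLinearMap.inverse_eq (ContinuousLinearMap.ext (mfderiv_smul_mfderiv_inv_smul EG g q))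
    (ContinuousLinearMap.ext (mfderiv_inv_smul_mfderiv_smul EG g q))

theorem mfderiv_smul_const_mulInvariantVectorField [LieGroup 𝓘(ℝ, EG) ∞ G]
    [IsManifold 𝓘(ℝ, E) ∞ Q] [ContMDiffSMul 𝓘(ℝ, EG) 𝓘(ℝ, E) ∞ G Q]
    (g : G) (q : Q) (ξ : GroupLieAlgebra 𝓘(ℝ, EG) G) :
    (mfderiv 𝓘(ℝ, EG) 𝓘(ℝ, E) (fun h : G => h • q) g (mulInvariantVectorField ξ g) : E) =
      mfderiv 𝓘(ℝ, E) 𝓘(ℝ, E) (fun x : Q => g • x) q (generator q ξ) :=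
  mfderiv_mfderiv_eq_of_comp_eventuallyEq (mdifferentiableAt_smul_const EG E q g)
    ((contMDiff_mul_left (I := 𝓘(ℝ, EG)) (n := ∞)).mdifferentiableAt (by simp)) (mul_one g)
    (mdifferentiableAt_const_smul EG g q) (mdifferentiableAt_smul_const EG E q 1) (one_smul G q)
    (.of_forall fun h => mul_smul g h q) ξ

theorem exists_isMIntegralCurveAt_mulInvariantVectorField [CompleteSpace EG]
    [LieGroup 𝓘(ℝ, EG) ∞ G] (ξ : GroupLieAlgebra 𝓘(ℝ, EG) G) :
    ∃ γ : ℝ → G, γ 0 = 1 ∧ IsMIntegralCurveAt γ (mulInvariantVectorField ξ) 0 := by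
  have : LieGroup 𝓘(ℝ, EG) (minSmoothness ℝ 3) G := by
    rw [minSmoothness_of_isRCLikeNormedField]
    exact LieGroup.of_le (n := ∞) ENat.LEInfty.out
  refine exists_isMIntegralCurveAt_of_contMDiffAt_boundaryless 0
    ((contMDiff_mulInvariantVectorField ξ).of_le ?_).contMDiffAt
  rw [minSmoothness_of_isRCLikeNormedField]
  exact one_le_two

theorem isMIntegralCurveAt_smul_const [LieGroup 𝓘(ℝ, EG) ∞ G] [IsManifold 𝓘(ℝ, E) ∞ Q]
    [ContMDiffSMul 𝓘(ℝ, EG) 𝓘(ℝ, E) ∞ G Q] {ξ : GroupLieAlgebra 𝓘(ℝ, EG) G} {γ : ℝ → G} {t₀ : ℝ}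
    (hγ : IsMIntegralCurveAt γ (mulInvariantVectorField ξ) t₀) {q : Q}
    (hξ : generator (E := E) q ξ = 0) :
    IsMIntegralCurveAt (I := 𝓘(ℝ, E)) (fun t => γ t • q)
      (fun _ => (0 : TangentSpace 𝓘(ℝ, E) _)) t₀ := by
  filter_upwards [hγ] with t ht
  refine ((mdifferentiableAt_smul_const EG E q (γ t)).hasMFDerivAt.comp t ht).congr_mfderiv ?_
  have hzero : (mfderiv 𝓘(ℝ, EG) 𝓘(ℝ, E) (fun h : G => h • q) (γ t)
      (mulInvariantVectorField ξ (γ t)) : E) = 0 :=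
    (mfderiv_smul_const_mulInvariantVectorField (γ t) q ξ).trans <| by rw [hξ]; exact map_zero _
  refine ContinuousLinearMap.ext_ring ((congrArg _ (one_smul ℝ _)).trans (hzero.trans ?_))
  exact (smul_zero (1 : ℝ)).symm

theorem generator_injective [CompleteSpace EG] [LieGroup 𝓘(ℝ, EG) ∞ G] [CompleteSpace E]
    [IsManifold 𝓘(ℝ, E) ∞ Q] [ContMDiffSMul 𝓘(ℝ, EG) 𝓘(ℝ, E) ∞ G Q] {q : Q}
    (hfree : ∀ g : G, g • q = q → g = 1) :
    Function.Injective (generator (EG := EG) (G := G) (E := E) q) := by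
  rw [injective_iff_map_eq_zero]
  intro ξ hξ
  obtain ⟨γ, h0, hγ⟩ := exists_isMIntegralCurveAt_mulInvariantVectorField ξ
  have hconst : IsMIntegralCurveAt (I := 𝓘(ℝ, E)) (fun _ : ℝ => q)
      (fun _ => (0 : TangentSpace 𝓘(ℝ, E) _)) 0 :=
    .of_forall fun t => (hasMFDerivAt_const q t).congr_mfderiv
      (ContinuousLinearMap.ext_ring (smul_zero (1 : ℝ)).symm)
  have hzero : ContMDiff 𝓘(ℝ, E) 𝓘(ℝ, E).tangent 1
      (fun x : Q => (⟨x, 0⟩ : TangentBundle 𝓘(ℝ, E) Q)) :=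
    contMDiff_zeroSection ℝ (fun x : Q => TangentSpace 𝓘(ℝ, E) x)
  have hstab : (fun t => γ t • q) =ᶠ[𝓝 0] fun _ => q :=
    isMIntegralCurveAt_eventuallyEq_of_contMDiffAt_boundaryless hzero.contMDiffAt
      (isMIntegralCurveAt_smul_const hγ hξ) hconst (by simp only [h0, one_smul])
  have hγ1 : (fun _ : ℝ => (1 : G)) =ᶠ[𝓝 0] γ := hstab.mono fun t ht => (hfree _ ht).symm
  have hd := hγ.self_of_nhds.congr_of_eventuallyEq hγ1
  have hγ0 : (mulInvariantVectorField ξ (γ 0) : EG) = 0 := (one_smul ℝ _).symm.trans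
    (DFunLike.congr_fun (hasMFDerivAt_unique hd (hasMFDerivAt_const (1 : G) (0 : ℝ))) (1 : ℝ))
  have hid : (fun h => γ 0 * h) = id := funext fun h => by rw [h0, one_mul, id]
  rwa [mulInvariantVectorField, hid, mfderiv_id] at hγ0

end Action

/-! ### Invariant frames and their reduction -/

/-- The `𝔤`-valued functions `ζ₁, …, ζₖ` on `Q` generate a `G`-invariant frame of the
distribution `S`: the fields `q ↦ (ζᵢ(q))_Q(q)` are pointwise a basis of `S` and are permuted by
the tangent lift of the action in the sense that `Tg ∘ Zᵢ = Zᵢ ∘ g`. -/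
structure IsInvariantFrame {EG G E Q : Type*} [NormedAddCommGroup EG] [NormedSpace ℝ EG]
    [TopologicalSpace G] [ChartedSpace EG G] [Group G] [NormedAddCommGroup E] [NormedSpace ℝ E]
    [TopologicalSpace Q] [ChartedSpace E Q] [IsManifold 𝓘(ℝ, E) ∞ Q] [MulAction G Q]
    (S : ∀ q : Q, Submodule ℝ (TangentSpace 𝓘(ℝ, E) q)) {k : ℕ}
    (ζ : Fin k → Q → GroupLieAlgebra 𝓘(ℝ, EG) G) : Prop where
  contMDiff : ∀ i, ContMDiff (M' := EG) 𝓘(ℝ, E) 𝓘(ℝ, EG) ∞ (ζ i)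
  linearIndependent : ∀ q, LinearIndependent ℝ fun i => generator (E := E) q (ζ i q)
  span_eq : ∀ q, Submodule.span ℝ (Set.range fun i => generator (E := E) q (ζ i q)) = S q
  generator_smul : ∀ i (g : G) q, generator (g • q) (ζ i (g • q)) =
    mfderiv 𝓘(ℝ, E) 𝓘(ℝ, E) (fun x : Q => g • x) q (generator q (ζ i q))

namespace IsReduction

variable {E Q EG G E' Q' EF F : Type*}
  [NormedAddCommGroup E] [NormedSpace ℝ E] [TopologicalSpace Q] [ChartedSpace E Q]
  [NormedAddCommGroup EG] [NormedSpace ℝ EG] [TopologicalSpace G] [ChartedSpace EG G] [Group G]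
  [NormedAddCommGroup E'] [NormedSpace ℝ E'] [TopologicalSpace Q'] [ChartedSpace E' Q']
  [NormedAddCommGroup EF] [NormedSpace ℝ EF] [TopologicalSpace F] [ChartedSpace EF F] [Group F]
  [MulAction G Q] [MulAction F Q'] {GW : Subgroup G} {ρ : Q → Q'} {pr : G →* F}

theorem map_eq_one (h : IsReduction (EG := EG) (E := E) (EF := EF) (E' := E') GW ρ pr)
    (w : GW) : pr w = 1 :=
  MonoidHom.mem_ker.1 (h.ker_eq ▸ w.2)

theorem eq_one_of_smul_eq_self (h : IsReduction (EG := EG) (E := E) (EF := EF) (E' := E') GW ρ pr)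
    (hfree : ∀ (g : G) (q : Q), g • q = q → g = 1) (x : Q') (f : F) (hx : f • x = x) : f = 1 := by
  obtain ⟨g, rfl⟩ := h.surjective_group f
  obtain ⟨q, rfl⟩ := h.surjective_base x
  rw [← h.equivariant, h.base_eq_iff] at hx
  obtain ⟨w, hw : (w : G) • q = g • q⟩ := hx
  have hgw : (w : G) = g :=
    inv_mul_eq_one.1 (hfree _ q (by rw [mul_smul, ← hw, inv_smul_smul]))
  rw [← hgw, h.map_eq_one]

section Base

variable [IsManifold 𝓘(ℝ, E) ∞ Q] [IsManifold 𝓘(ℝ, E') ∞ Q']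

theorem ker_mfderiv (h : IsReduction (EG := EG) (E := E) (EF := EF) (E' := E') GW ρ pr) {q : Q}
    {W : Submodule ℝ (TangentSpace 𝓘(ℝ, E) q)}
    (hW : (W : Set (TangentSpace 𝓘(ℝ, E) q)) =
      tangentVectors 𝓘(ℝ, E) (MulAction.orbit GW q) q) :
    LinearMap.ker (mfderiv 𝓘(ℝ, E) 𝓘(ℝ, E') ρ q).toLinearMap = W := by
  have hfiber : ρ ⁻¹' {ρ q} = MulAction.orbit GW q := Set.ext fun y => h.base_eq_iff y q
  refine SetLike.coe_injective (hW.symm ▸ Set.Subset.antisymm (fun v hv => ?_) fun v hv => ?_)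
  · exact hfiber ▸ mem_tangentVectors_fiber (h.isSubmersion_base.isSubmersionAt q) hv
  · have hconst := mfderiv_apply_eq_of_mem_tangentVectors (I' := 𝓘(ℝ, E')) (g := fun _ => ρ q) hv
      (h.isSubmersion_base.contMDiff.mdifferentiableAt (by simp)) mdifferentiableAt_const
      fun y hy => (h.base_eq_iff y q).2 hy
    rw [mfderiv_const] at hconst
    exact hconst

theorem contMDiff_of_apply_eq
    (h : IsReduction (EG := EG) (E := E) (EF := EF) (E' := E') GW ρ pr)
    {ξ : Q → GroupLieAlgebra 𝓘(ℝ, EG) G} (hξ : ContMDiff (M' := EG) 𝓘(ℝ, E) 𝓘(ℝ, EG) ∞ ξ)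
    {ν : Q' → GroupLieAlgebra 𝓘(ℝ, EF) F} (hν : ∀ q, ν (ρ q) = lieProjection pr (ξ q)) :
    ContMDiff (M' := EF) 𝓘(ℝ, E') 𝓘(ℝ, EF) ∞ ν := by
  intro x
  obtain ⟨q, rfl⟩ := h.surjective_base x
  obtain ⟨σ, hσ, -, hρσ⟩ := exists_contMDiffAt_section (h.isSubmersion_base.isSubmersionAt q)
  let A : EG →L[ℝ] EF := lieProjection pr
  let ξ' : Q → EG := ξ
  have hlift : ContMDiffAt 𝓘(ℝ, E') 𝓘(ℝ, EF) ∞ (A ∘ ξ' ∘ σ) (ρ q) :=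
    A.contDiff.contMDiff.contMDiffAt.comp (ρ q) ((hξ _).comp (ρ q) hσ)
  refine hlift.congr_of_eventuallyEq ?_
  filter_upwards [hρσ] with y hy using (congrArg ν hy).symm.trans (hν (σ y))

end Base

variable [LieGroup 𝓘(ℝ, EG) ∞ G] [LieGroup 𝓘(ℝ, EF) ∞ F]

theorem lieProjection_surjective
    (h : IsReduction (EG := EG) (E := E) (EF := EF) (E' := E') GW ρ pr) :
    Function.Surjective (lieProjection (EG := EG) (EF := EF) pr) := by
  intro ν
  obtain ⟨s, hs, hs1, hprs⟩ :=
    exists_contMDiffAt_section (h.isSubmersion_group.isSubmersionAt (1 : G))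
  rw [map_one] at hs hs1 hprs
  exact ⟨mfderiv 𝓘(ℝ, EF) 𝓘(ℝ, EG) s 1 ν, mfderiv_mfderiv_eq_self
    (h.isSubmersion_group.contMDiff.mdifferentiableAt (by simp))
    (hs.mdifferentiableAt (by simp)) hs1 hprs ν⟩

variable [IsManifold 𝓘(ℝ, E) ∞ Q] [IsManifold 𝓘(ℝ, E') ∞ Q']
  [ContMDiffSMul 𝓘(ℝ, EG) 𝓘(ℝ, E) ∞ G Q]

theorem contMDiffSMul (h : IsReduction (EG := EG) (E := E) (EF := EF) (E' := E') GW ρ pr) :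
    ContMDiffSMul 𝓘(ℝ, EF) 𝓘(ℝ, E') ∞ F Q' := by
  refine ⟨fun ⟨f, x⟩ => ?_⟩
  obtain ⟨g, rfl⟩ := h.surjective_group f
  obtain ⟨q, rfl⟩ := h.surjective_base x
  obtain ⟨s, hs, -, hprs⟩ := exists_contMDiffAt_section (h.isSubmersion_group.isSubmersionAt g)
  obtain ⟨σ, hσ, -, hρσ⟩ := exists_contMDiffAt_section (h.isSubmersion_base.isSubmersionAt q)
  have hlift : ContMDiffAt (𝓘(ℝ, EF).prod 𝓘(ℝ, E')) 𝓘(ℝ, E) ∞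
      (fun p : F × Q' => s p.1 • σ p.2) (pr g, ρ q) :=
    (hs.comp (pr g, ρ q) contMDiffAt_fst).smul (hσ.comp (pr g, ρ q) contMDiffAt_snd)
  refine ((h.isSubmersion_base.contMDiff _).comp (pr g, ρ q) hlift).congr_of_eventuallyEq ?_
  rw [nhds_prod_eq]
  filter_upwards [hprs.prod_mk hρσ] with p ⟨hp₁, hp₂⟩
  rw [Function.comp_apply, h.equivariant, hp₁, hp₂]

theorem mfderiv_generator (h : IsReduction (EG := EG) (E := E) (EF := EF) (E' := E') GW ρ pr)
    (q : Q) (ξ : GroupLieAlgebra 𝓘(ℝ, EG) G) :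
    mfderiv 𝓘(ℝ, E) 𝓘(ℝ, E') ρ q (generator q ξ) =
      generator (EG := EF) (E := E') (ρ q) (lieProjection pr ξ) := by
  have := h.contMDiffSMul
  exact mfderiv_mfderiv_eq_of_comp_eventuallyEq
    (h.isSubmersion_base.contMDiff.mdifferentiableAt (by simp))
    (mdifferentiableAt_smul_const EG E q 1) (one_smul G q)
    (mdifferentiableAt_smul_const EF E' (ρ q) 1)
    (h.isSubmersion_group.contMDiff.mdifferentiableAt (by simp)) (map_one pr)
    (.of_forall fun g => h.equivariant g q) ξ

theorem mfderiv_smul (h : IsReduction (EG := EG) (E := E) (EF := EF) (E' := E') GW ρ pr)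
    (g : G) (q : Q) (v : TangentSpace 𝓘(ℝ, E) q) :
    (mfderiv 𝓘(ℝ, E) 𝓘(ℝ, E') ρ (g • q)
      (mfderiv 𝓘(ℝ, E) 𝓘(ℝ, E) (fun x : Q => g • x) q v) : E') =
      mfderiv 𝓘(ℝ, E') 𝓘(ℝ, E') (fun x : Q' => pr g • x) (ρ q)
        (mfderiv 𝓘(ℝ, E) 𝓘(ℝ, E') ρ q v) := by
  have := h.contMDiffSMul
  have hρ : ∀ q, MDifferentiableAt 𝓘(ℝ, E) 𝓘(ℝ, E') ρ q := fun q =>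
    h.isSubmersion_base.contMDiff.mdifferentiableAt (by simp)
  exact mfderiv_mfderiv_eq_of_comp_eventuallyEq (hρ _) (mdifferentiableAt_const_smul EG g q) rfl
    (mdifferentiableAt_const_smul EF (pr g) (ρ q)) (hρ q) rfl (.of_forall (h.equivariant g)) v

theorem map_mfderiv_verticalSpace
    (h : IsReduction (EG := EG) (E := E) (EF := EF) (E' := E') GW ρ pr) (q : Q) :
    (verticalSpace EG G q).map (mfderiv 𝓘(ℝ, E) 𝓘(ℝ, E') ρ q).toLinearMap =
      verticalSpace (E := E') EF F (ρ q) := by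
  refine le_antisymm ?_ ?_
  · rintro _ ⟨_, ⟨ξ, rfl⟩, rfl⟩
    exact ⟨lieProjection pr ξ, (h.mfderiv_generator q ξ).symm⟩
  · rintro _ ⟨ν, rfl⟩
    obtain ⟨ξ, rfl⟩ := h.lieProjection_surjective ν
    exact ⟨generator q ξ, ⟨ξ, rfl⟩, h.mfderiv_generator q ξ⟩

variable {S : ∀ q : Q, Submodule ℝ (TangentSpace 𝓘(ℝ, E) q)} {k : ℕ}
  {ζ : Fin k → Q → GroupLieAlgebra 𝓘(ℝ, EG) G}

theorem generator_lieProjection_smul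
    (h : IsReduction (EG := EG) (E := E) (EF := EF) (E' := E') GW ρ pr)
    (hζ : IsInvariantFrame S ζ) (i : Fin k) (g : G) (q : Q) :
    generator (EG := EF) (E := E') (ρ (g • q)) (lieProjection pr (ζ i (g • q))) =
      (mfderiv 𝓘(ℝ, E') 𝓘(ℝ, E') (fun x : Q' => pr g • x) (ρ q)
        (generator (EG := EF) (ρ q) (lieProjection pr (ζ i q))) : E') := by
  rw [← h.mfderiv_generator, hζ.generator_smul, ← h.mfderiv_generator]
  exact h.mfderiv_smul g q _

theorem reducedSymmetry_apply
    (h : IsReduction (EG := EG) (E := E) (EF := EF) (E' := E') GW ρ pr)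
    (hinj : ∀ x : Q', Function.Injective (generator (EG := EF) (G := F) (E := E') x))
    (hζ : IsInvariantFrame S ζ) (i : Fin k) (q : Q) :
    reducedSymmetry (EG := EG) (EF := EF) pr h.surjective_base (ζ i) (ρ q) =
      lieProjection pr (ζ i q) := by
  obtain ⟨w, hw⟩ := (h.base_eq_iff _ q).1 (Function.surjInv_eq h.surjective_base (ρ q))
  have hwq : ρ ((w : G) • q) = ρ q := (h.base_eq_iff _ q).2 ⟨w, rfl⟩
  have hsmul := h.generator_lieProjection_smul hζ i w q
  rw [h.map_eq_one, show (fun x : Q' => (1 : F) • x) = id from funext (one_smul F), mfderiv_id,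
    hwq] at hsmul
  rw [reducedSymmetry, ← hw]
  exact hinj (ρ q) hsmul

theorem isInvariantFrame (h : IsReduction (EG := EG) (E := E) (EF := EF) (E' := E') GW ρ pr)
    (hζ : IsInvariantFrame S ζ) {W : ∀ q : Q, Submodule ℝ (TangentSpace 𝓘(ℝ, E) q)}
    (hSW : ∀ q, Disjoint (S q) (W q)) (hV : ∀ q, S q ⊔ W q = verticalSpace EG G q)
    (hW : ∀ q, (W q : Set (TangentSpace 𝓘(ℝ, E) q)) =
      tangentVectors 𝓘(ℝ, E) (MulAction.orbit GW q) q)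
    {η : Fin k → Q' → GroupLieAlgebra 𝓘(ℝ, EF) F}
    (hη : ∀ i q, η i (ρ q) = lieProjection pr (ζ i q)) :
    IsInvariantFrame (verticalSpace (E := E') EF F) η where
  contMDiff i := h.contMDiff_of_apply_eq (hζ.contMDiff i) (hη i)
  linearIndependent x := by
    obtain ⟨q, rfl⟩ := h.surjective_base x
    simp only [hη, ← h.mfderiv_generator]
    refine (hζ.linearIndependent q).map (f := (mfderiv 𝓘(ℝ, E) 𝓘(ℝ, E') ρ q).toLinearMap) ?_
    rw [hζ.span_eq, h.ker_mfderiv (hW q)]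
    exact hSW q
  span_eq x := by
    obtain ⟨q, rfl⟩ := h.surjective_base x
    have hmapW : (W q).map (mfderiv 𝓘(ℝ, E) 𝓘(ℝ, E') ρ q).toLinearMap = ⊥ :=
      LinearMap.le_ker_iff_map.1 (h.ker_mfderiv (hW q)).ge
    rw [← h.map_mfderiv_verticalSpace, ← hV, Submodule.map_sup, hmapW, sup_bot_eq, ← hζ.span_eq,
      Submodule.map_span, ← Set.range_comp]
    simp only [hη, ← h.mfderiv_generator]
    rfl
  generator_smul i f x := by
    obtain ⟨g, rfl⟩ := h.surjective_group f
    obtain ⟨q, rfl⟩ := h.surjective_base x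
    have hsmul := h.generator_lieProjection_smul hζ i g q
    rwa [← hη, ← hη, h.equivariant] at hsmul

end IsReduction

/-! ### Momentum functions on the cotangent bundle -/

theorem hasMFDerivAt_clm_apply_of_eq_zero {E H M V V' : Type*} [NormedAddCommGroup E]
    [NormedSpace ℝ E] [TopologicalSpace H] {I : ModelWithCorners ℝ E H} [TopologicalSpace M]
    [ChartedSpace H M] [NormedAddCommGroup V] [NormedSpace ℝ V] [NormedAddCommGroup V']
    [NormedSpace ℝ V'] {p : M → V →L[ℝ] V'} {p' : E →L[ℝ] V →L[ℝ] V'} {y : M → V} {x : M}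
    (hp : HasMFDerivAt I 𝓘(ℝ, V →L[ℝ] V') p x p') (hy : MDifferentiableAt I 𝓘(ℝ, V) y x)
    (hpx : p x = 0) : HasMFDerivAt I 𝓘(ℝ, V') (fun z => p z (y z)) x (p'.flip (y x)) := by
  have hbilin := (isBoundedBilinearMap_apply (𝕜 := ℝ) (E := V) (F := V')).hasFDerivAt (p x, y x)
  have hpair : HasMFDerivAt I 𝓘(ℝ, (V →L[ℝ] V') × V) (fun z => (p z, y z)) x
      (p'.prod (mfderiv I 𝓘(ℝ, V) y x : E →L[ℝ] V)) :=
    ⟨hp.1.prodMk hy.hasMFDerivAt.1, hp.2.prodMk hy.hasMFDerivAt.2⟩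
  refine (HasMFDerivAt.comp x hbilin.hasMFDerivAt hpair).congr_mfderiv
    (ContinuousLinearMap.ext fun v => ?_)
  change p x (mfderiv I 𝓘(ℝ, V) y x v) + _ = _
  rw [hpx]
  exact zero_add _

section CotangentBundle

variable {E Q : Type*} [NormedAddCommGroup E] [NormedSpace ℝ E] [TopologicalSpace Q]
  [ChartedSpace E Q] [IsManifold 𝓘(ℝ, E) ∞ Q]

theorem inCoordinates_cotangent (q x : Q) (p : TangentSpace 𝓘(ℝ, E) x →L[ℝ] Trivial Q ℝ x) :
    ContinuousLinearMap.inCoordinates E (fun x : Q => TangentSpace 𝓘(ℝ, E) x) ℝ (Trivial Q ℝ)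
      q x q x p = p ∘L (trivializationAt E (fun x : Q => TangentSpace 𝓘(ℝ, E) x) q).symmL ℝ x := by
  simp only [ContinuousLinearMap.inCoordinates, Trivial.eq_trivialization,
    Trivial.continuousLinearMapAt_trivialization, ContinuousLinearMap.id_comp]

theorem contMDiffAt_cotangentBundle_iff {E' H' M : Type*} [NormedAddCommGroup E']
    [NormedSpace ℝ E'] [TopologicalSpace H'] {I : ModelWithCorners ℝ E' H'} [TopologicalSpace M]
    [ChartedSpace H' M] {f : M → CotangentBundle E Q} {x₀ : M} :
    ContMDiffAt I (cotangentModel E) ∞ f x₀ ↔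
      ContMDiffAt I 𝓘(ℝ, E) ∞ (fun x => (f x).proj) x₀ ∧
      ContMDiffAt I 𝓘(ℝ, E →L[ℝ] ℝ) ∞ (fun x => ((f x).2 ∘L
        (trivializationAt E (fun y : Q => TangentSpace 𝓘(ℝ, E) y) (f x₀).proj).symmL ℝ
          (f x).proj : E →L[ℝ] ℝ)) x₀ := by
  rw [contMDiffAt_hom_bundle]
  simp only [inCoordinates_cotangent]

theorem contMDiff_fiberLine (α : CotangentBundle E Q)
    (β : TangentSpace 𝓘(ℝ, E) α.proj →L[ℝ] Trivial Q ℝ α.proj) :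
    ContMDiff 𝓘(ℝ, ℝ) (cotangentModel E) ∞
      (fun t : ℝ => (⟨α.proj, α.2 + t • β⟩ : CotangentBundle E Q)) := by
  intro t
  refine contMDiffAt_cotangentBundle_iff.2 ⟨contMDiffAt_const, ?_⟩
  let s : E →L[ℝ] E :=
    (trivializationAt E (fun x : Q => TangentSpace 𝓘(ℝ, E) x) α.proj).symmL ℝ α.proj
  have hline : ContDiff ℝ ∞ fun t : ℝ => (α.2 ∘L s : E →L[ℝ] ℝ) + t • (β ∘L s : E →L[ℝ] ℝ) := by
    fun_prop
  exact hline.contMDiff.contMDiffAt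

/-- The fibrewise linear function `α ↦ α(Y)` on `T*Q` attached to a vector field `Y` on `Q`, its
momentum function. -/
noncomputable def momentumFunction (Y : ∀ x : Q, TangentSpace 𝓘(ℝ, E) x)
    (α : CotangentBundle E Q) : ℝ :=
  α.2 (Y α.proj)

variable {Y : ∀ x : Q, TangentSpace 𝓘(ℝ, E) x}

theorem contMDiff_momentumFunction (hY : ContMDiff 𝓘(ℝ, E) 𝓘(ℝ, E).tangent ∞ (T% Y)) :
    ContMDiff (cotangentModel E) 𝓘(ℝ, ℝ) ∞ (momentumFunction Y) := by
  have happly := ContMDiff.clm_bundle_apply (n := ∞) (IM := cotangentModel E) (IB := 𝓘(ℝ, E))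
    (F₁ := E) (F₂ := ℝ) (E₁ := fun x : Q => TangentSpace 𝓘(ℝ, E) x) (E₂ := Trivial Q ℝ)
    (b := fun α : CotangentBundle E Q => α.proj) (ϕ := fun α => α.2) (v := fun α => Y α.proj)
    contMDiff_id (hY.comp (contMDiff_proj _))
  exact fun α => (contMDiffAt_totalSpace.1 (happly α)).2

theorem exists_forall_mfderiv_momentumFunction (α : CotangentBundle E Q)
    (β : TangentSpace 𝓘(ℝ, E) α.proj →L[ℝ] Trivial Q ℝ α.proj) :
    ∃ w : TangentSpace (cotangentModel E) α, ∀ Y : ∀ x : Q, TangentSpace 𝓘(ℝ, E) x,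
      ContMDiff 𝓘(ℝ, E) 𝓘(ℝ, E).tangent ∞ (T% Y) →
      mfderiv (cotangentModel E) 𝓘(ℝ, ℝ) (momentumFunction Y) α w = β (Y α.proj) := by
  let γ : ℝ → CotangentBundle E Q := fun t => ⟨α.proj, α.2 + t • β⟩
  have hγ0 : γ 0 = α := by simp only [γ, zero_smul, add_zero]
  have hγ : MDifferentiableAt 𝓘(ℝ, ℝ) (cotangentModel E) γ 0 :=
    (contMDiff_fiberLine α β).mdifferentiableAt (by simp)
  refine ⟨(mfderiv 𝓘(ℝ, ℝ) (cotangentModel E) γ 0 : ℝ →L[ℝ] E × (E →L[ℝ] ℝ)) 1, fun Y hY => ?_⟩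
  have hline : HasFDerivAt (fun t : ℝ => (α.2 (Y α.proj) : ℝ) + t • (β (Y α.proj) : ℝ))
      ((ContinuousLinearMap.id ℝ ℝ).smulRight (β (Y α.proj) : ℝ)) 0 :=
    ((ContinuousLinearMap.id ℝ ℝ).smulRight (β (Y α.proj) : ℝ)).hasFDerivAt.const_add _
  have hcomp := mfderiv_mfderiv_eq_of_comp_eventuallyEq (I' := 𝓘(ℝ, ℝ))
    ((contMDiff_momentumFunction hY).mdifferentiableAt (by simp)) hγ hγ0
    hline.hasMFDerivAt.mdifferentiableAt mdifferentiableAt_id rfl (.of_forall fun _ => rfl) (1 : ℝ)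
  rw [hline.hasMFDerivAt.mfderiv, mfderiv_id] at hcomp
  exact hcomp.trans (one_smul ℝ (β (Y α.proj) : ℝ))

theorem momentumFunction_eventuallyEq (q : Q) (α : CotangentBundle E Q) (hα : α.proj = q) :
    momentumFunction Y =ᶠ[𝓝 α]
      fun γ => (γ.2 ∘L (trivializationAt E (fun x : Q => TangentSpace 𝓘(ℝ, E) x) q).symmL ℝ γ.proj)
        (trivializationAt E (fun x : Q => TangentSpace 𝓘(ℝ, E) x) q ⟨γ.proj, Y γ.proj⟩).2 := by
  set e := trivializationAt E (fun x : Q => TangentSpace 𝓘(ℝ, E) x) q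
  have hbase : ∀ᶠ γ : CotangentBundle E Q in 𝓝 α, γ.proj ∈ e.baseSet :=
    (FiberBundle.continuous_proj _ _).continuousAt (e.open_baseSet.mem_nhds (by simp [hα, e]))
  filter_upwards [hbase] with γ hγ
  have hcoord : (e ⟨γ.proj, Y γ.proj⟩).2 = e.continuousLinearMapAt ℝ γ.proj (Y γ.proj) :=
    (congrFun (e.coe_linearMapAt_of_mem (R := ℝ) hγ) (Y γ.proj)).symm
  rw [hcoord]
  exact congrArg γ.2 (e.symmL_continuousLinearMapAt hγ _).symm

theorem exists_forall_mfderiv_momentumFunction_zero (q : Q)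
    (w : TangentSpace (cotangentModel E) (⟨q, 0⟩ : CotangentBundle E Q)) :
    ∃ β : TangentSpace 𝓘(ℝ, E) q →L[ℝ] ℝ, ∀ Y : ∀ x : Q, TangentSpace 𝓘(ℝ, E) x,
      ContMDiff 𝓘(ℝ, E) 𝓘(ℝ, E).tangent ∞ (T% Y) →
      mfderiv (cotangentModel E) 𝓘(ℝ, ℝ) (momentumFunction Y) ⟨q, 0⟩ w = β (Y q) := by
  let e := trivializationAt E (fun x : Q => TangentSpace 𝓘(ℝ, E) x) q
  let p : CotangentBundle E Q → (E →L[ℝ] ℝ) := fun γ => γ.2 ∘L e.symmL ℝ γ.proj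
  have hp : ContMDiffAt (cotangentModel E) 𝓘(ℝ, E →L[ℝ] ℝ) ∞ p ⟨q, 0⟩ :=
    (contMDiffAt_cotangentBundle_iff.1
      (contMDiffAt_id (M := CotangentBundle E Q) (x := ⟨q, 0⟩))).2
  let p' : E × (E →L[ℝ] ℝ) →L[ℝ] E →L[ℝ] ℝ :=
    mfderiv (cotangentModel E) 𝓘(ℝ, E →L[ℝ] ℝ) p ⟨q, 0⟩
  have hp' : HasMFDerivAt (cotangentModel E) 𝓘(ℝ, E →L[ℝ] ℝ) p ⟨q, 0⟩ p' :=
    (hp.mdifferentiableAt (by simp)).hasMFDerivAt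
  refine ⟨p' w ∘L e.continuousLinearMapAt ℝ q, fun Y hY => ?_⟩
  have hy : ContMDiffAt (cotangentModel E) 𝓘(ℝ, E) ∞
      (fun γ : CotangentBundle E Q => (e ⟨γ.proj, Y γ.proj⟩).2) ⟨q, 0⟩ :=
    (contMDiffAt_totalSpace.1 ((hY.comp (contMDiff_proj _)) ⟨q, 0⟩)).2
  have happly := (hasMFDerivAt_clm_apply_of_eq_zero hp' (hy.mdifferentiableAt (by simp))
    (ContinuousLinearMap.zero_comp _)).congr_of_eventuallyEq
      (momentumFunction_eventuallyEq q ⟨q, 0⟩ rfl)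
  rw [happly.mfderiv]
  exact congrArg (p' w) (congrFun (e.coe_linearMapAt_of_mem (R := ℝ)
    (FiberBundle.mem_baseSet_trivializationAt' q)) (Y q)).symm

end CotangentBundle

section CotangentLift

variable {EG G E Q : Type*}
  [NormedAddCommGroup EG] [NormedSpace ℝ EG] [TopologicalSpace G] [ChartedSpace EG G] [Group G]
  [NormedAddCommGroup E] [NormedSpace ℝ E] [TopologicalSpace Q] [ChartedSpace E Q]
  [MulAction G Q]

variable (EG) in
theorem cotangentLift_mfderiv_smul [ContMDiffSMul 𝓘(ℝ, EG) 𝓘(ℝ, E) ∞ G Q] (g : G)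
    (α : CotangentBundle E Q) (v : TangentSpace 𝓘(ℝ, E) α.proj) :
    (cotangentLift g α).2 (mfderiv 𝓘(ℝ, E) 𝓘(ℝ, E) (fun x : Q => g • x) α.proj v) = α.2 v := by
  refine congrArg α.2 (Eq.trans ?_ (mfderiv_inv_smul_mfderiv_smul EG g α.proj v))
  exact DFunLike.congr_fun (mfderiv_smul_inverse EG g α.proj) _

variable (EG) in
theorem cotangentLift_one [ContMDiffSMul 𝓘(ℝ, EG) 𝓘(ℝ, E) ∞ G Q] (α : CotangentBundle E Q) :
    cotangentLift (1 : G) α = α := by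
  obtain ⟨q, p⟩ := α
  have hid : (fun x : Q => (1 : G) • x) = id := funext (one_smul G)
  have hp : ∀ v : E, (cotangentLift (1 : G) (⟨q, p⟩ : CotangentBundle E Q)).2 v = p v := by
    intro v
    have hv := cotangentLift_mfderiv_smul EG (1 : G) (⟨q, p⟩ : CotangentBundle E Q) v
    rwa [hid, mfderiv_id] at hv
  have hext : ∀ (q' : Q) (p' : E →L[ℝ] ℝ), q' = q → p' = p →
      (⟨q', p'⟩ : CotangentBundle E Q) = ⟨q, p⟩ := by
    rintro _ _ rfl rfl
    rfl
  exact hext _ _ (one_smul G q) (ContinuousLinearMap.ext hp)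

variable [IsManifold 𝓘(ℝ, E) ∞ Q] [LieGroup 𝓘(ℝ, EG) ∞ G]
  [ContMDiffSMul 𝓘(ℝ, EG) 𝓘(ℝ, E) ∞ G Q]

theorem contMDiffAt_cotangentLift (α : CotangentBundle E Q) :
    ContMDiffAt 𝓘(ℝ, EG) (cotangentModel E) ∞ (fun g : G => cotangentLift g α) 1 := by
  refine contMDiffAt_cotangentBundle_iff.2 ⟨(contMDiff_smul_const EG E α.proj).contMDiffAt, ?_⟩
  let e := trivializationAt E (fun x : Q => TangentSpace 𝓘(ℝ, E) x)
  have hinv : ContMDiffAt (𝓘(ℝ, EG).prod 𝓘(ℝ, E)) 𝓘(ℝ, E) ∞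
      (Function.uncurry fun (g : G) (y : Q) => g⁻¹ • y) (1, (1 : G) • α.proj) :=
    (contMDiff_fst.inv.smul contMDiff_snd).contMDiffAt
  have hderiv := ContMDiffAt.mfderiv (m := ∞) (fun (g : G) (y : Q) => g⁻¹ • y)
    (fun g : G => g • α.proj) hinv (contMDiff_smul_const EG E α.proj).contMDiffAt (by simp)
  let b : Q := (1 : G)⁻¹ • (1 : G) • α.proj
  let L : E →L[ℝ] ℝ := α.2 ∘L (e b).symmL ℝ α.proj
  have hL : ∀ (y : Q) (v : E), y = α.proj → L ((e b).continuousLinearMapAt ℝ y v) = α.2 v := by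
    rintro y v rfl
    exact congrArg α.2 ((e b).symmL_continuousLinearMapAt (by simp [e, b]) v)
  refine (contMDiffAt_const (c := L)).clm_comp hderiv |>.congr_of_eventuallyEq
    (.of_forall fun g => ContinuousLinearMap.ext fun v => ?_)
  refine Eq.trans ?_ (hL _ _ (inv_smul_smul g α.proj)).symm
  exact congrArg α.2 (DFunLike.congr_fun (mfderiv_smul_inverse EG g α.proj) _)

theorem momentumMap_apply (α : CotangentBundle E Q) (ξ : GroupLieAlgebra 𝓘(ℝ, EG) G) :
    momentumMap α ξ = α.2 (generator α.proj ξ) := by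
  have hproj := mfderiv_mfderiv_eq_of_comp_eventuallyEq (I' := 𝓘(ℝ, E))
    ((contMDiff_proj (n := ∞) (IB := 𝓘(ℝ, E)) _).mdifferentiableAt (x := α) (by simp))
    ((contMDiffAt_cotangentLift (EG := EG) (G := G) α).mdifferentiableAt (by simp))
    (cotangentLift_one EG α) mdifferentiableAt_id (mdifferentiableAt_smul_const EG E α.proj 1) rfl
    (.of_forall fun _ => rfl) ξ
  rw [mfderiv_id] at hproj
  exact congrArg (α.2 : E →L[ℝ] ℝ) hproj

theorem gaugeMomentum_eq_momentumFunction (ξ : Q → GroupLieAlgebra 𝓘(ℝ, EG) G) :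
    gaugeMomentum ξ = momentumFunction (E := E) fun q => generator q (ξ q) :=
  funext fun α => momentumMap_apply α (ξ α.proj)

/-- The vector field is the derivative of `g ↦ g • x` at `1`, applied to the smooth section
`x ↦ (1, ξ(x))` of `TG` along a constant map. -/
theorem contMDiff_generator {ξ : Q → GroupLieAlgebra 𝓘(ℝ, EG) G}
    (hξ : ContMDiff (M' := EG) 𝓘(ℝ, E) 𝓘(ℝ, EG) ∞ ξ) :
    ContMDiff 𝓘(ℝ, E) 𝓘(ℝ, E).tangent ∞ (T% fun x : Q => generator (E := E) x (ξ x)) := by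
  intro q
  have hact : ContMDiffAt (𝓘(ℝ, E).prod 𝓘(ℝ, EG)) 𝓘(ℝ, E) ∞
      (Function.uncurry fun (y : Q) (g : G) => g • y) (q, 1) :=
    (contMDiff_snd.smul contMDiff_fst).contMDiffAt
  have hderiv := ContMDiffAt.mfderiv (m := ∞) (fun (y : Q) (g : G) => g • y)
    (fun _ : Q => (1 : G)) hact contMDiffAt_const (by simp)
  have hsection : ContMDiffAt 𝓘(ℝ, E) 𝓘(ℝ, EG).tangent ∞
      (fun x : Q => (⟨1, ξ x⟩ : TangentBundle 𝓘(ℝ, EG) G)) q := by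
    rw [contMDiffAt_totalSpace]
    refine ⟨contMDiffAt_const, ?_⟩
    let e := trivializationAt EG (fun g : G => TangentSpace 𝓘(ℝ, EG) g) 1
    let A : EG →L[ℝ] EG := e.continuousLinearMapAt ℝ 1
    have hcoord : ContMDiffAt 𝓘(ℝ, E) 𝓘(ℝ, EG) ∞ (A ∘ ξ) q :=
      ContMDiffAt.comp (I' := 𝓘(ℝ, EG)) (M' := EG) q A.contDiff.contMDiff.contMDiffAt (hξ q)
    exact hcoord.congr_of_eventuallyEq (.of_forall fun x => (congrFun (e.coe_linearMapAt_of_mem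
      (R := ℝ) (FiberBundle.mem_baseSet_trivializationAt' 1)) (ξ x)).symm)
  have happly := ContMDiffAt.clm_apply_of_inCoordinates (b₁ := fun _ : Q => (1 : G))
    (b₂ := fun y : Q => (1 : G) • y) (v := ξ) hderiv hsection
    (ContMDiffSMul.contMDiff_const_smul (n := ∞) (I := 𝓘(ℝ, EG)) (1 : G)).contMDiffAt
  have hext : ∀ (x x' : Q) (v : E), x = x' →
      (⟨x, v⟩ : TangentBundle 𝓘(ℝ, E) Q) = ⟨x', v⟩ := by
    rintro _ _ _ rfl
    rfl
  exact happly.congr_of_eventuallyEq (.of_forall fun x => hext _ _ _ (one_smul G x).symm)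

end CotangentLift

/-! ### Horizontal gauge symmetries -/

namespace NonholonomicSystem

variable {E Q EG G : Type*} [NormedAddCommGroup E] [NormedSpace ℝ E]
  [TopologicalSpace Q] [ChartedSpace E Q] [IsManifold 𝓘(ℝ, E) ∞ Q]
  [NormedAddCommGroup EG] [NormedSpace ℝ EG] [Group G] [MulAction G Q]
  {𝒩 : NonholonomicSystem E Q}

theorem IsSymmetry.inner_mfderiv_self (h : 𝒩.IsSymmetry G) (g : G) (q : Q)
    (v : TangentSpace 𝓘(ℝ, E) q) :
    𝒩.κ.inner (g • q) (mfderiv 𝓘(ℝ, E) 𝓘(ℝ, E) (fun x : Q => g • x) q v)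
      (mfderiv 𝓘(ℝ, E) 𝓘(ℝ, E) (fun x : Q => g • x) q v) = 𝒩.κ.inner q v v := by
  set A := mfderiv 𝓘(ℝ, E) 𝓘(ℝ, E) (fun x : Q => g • x) q
  have hL : ∀ w : TangentSpace 𝓘(ℝ, E) q,
      1 / 2 * 𝒩.κ.inner (g • q) (A w) (A w) - 𝒩.U (g • q) =
        1 / 2 * 𝒩.κ.inner q w w - 𝒩.U q := fun w => (h g).1 ⟨q, w⟩
  have hU : 𝒩.U (g • q) = 𝒩.U q := by simpa using hL 0
  linarith [hL v]

theorem IsSymmetry.inner_mfderiv (h : 𝒩.IsSymmetry G) (g : G) (q : Q)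
    (u v : TangentSpace 𝓘(ℝ, E) q) :
    𝒩.κ.inner (g • q) (mfderiv 𝓘(ℝ, E) 𝓘(ℝ, E) (fun x : Q => g • x) q u)
      (mfderiv 𝓘(ℝ, E) 𝓘(ℝ, E) (fun x : Q => g • x) q v) = 𝒩.κ.inner q u v := by
  have hadd := h.inner_mfderiv_self g q (u + v)
  simp only [map_add, add_apply, h.inner_mfderiv_self, 𝒩.κ.symm q v u,
    𝒩.κ.symm (g • q) (mfderiv 𝓘(ℝ, E) 𝓘(ℝ, E) (fun x : Q => g • x) q v)] at hadd
  linarith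

variable [TopologicalSpace G] [ChartedSpace EG G]

theorem IsSymmetry.exists_mfderiv_eq [ContMDiffSMul 𝓘(ℝ, EG) 𝓘(ℝ, E) ∞ G Q]
    (h : 𝒩.IsSymmetry G) (g : G) (q : Q) {w : TangentSpace 𝓘(ℝ, E) (g • q)}
    (hw : w ∈ 𝒩.D (g • q)) :
    ∃ u ∈ 𝒩.D q, mfderiv 𝓘(ℝ, E) 𝓘(ℝ, E) (fun x : Q => g • x) q u = w := by
  have hD : ∀ (y : Q) (u : E), y = q → u ∈ 𝒩.D y → u ∈ 𝒩.D q := by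
    rintro y u rfl hu
    exact hu
  exact ⟨mfderiv 𝓘(ℝ, E) 𝓘(ℝ, E) (fun x : Q => g⁻¹ • x) (g • q) w,
    hD _ _ (inv_smul_smul g q) ((h g⁻¹).2 (g • q) w hw), mfderiv_smul_mfderiv_inv_smul EG g q w⟩

theorem IsSymmetry.cotangentLift_legendre [ContMDiffSMul 𝓘(ℝ, EG) 𝓘(ℝ, E) ∞ G Q]
    (h : 𝒩.IsSymmetry G) (g : G) (v : TangentBundle 𝓘(ℝ, E) Q) :
    cotangentLift g (𝒩.legendre v) =
      𝒩.legendre (tangentMap 𝓘(ℝ, E) 𝓘(ℝ, E) (fun x : Q => g • x) v) := by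
  obtain ⟨q, v⟩ := v
  have hcov : ∀ w : TangentSpace 𝓘(ℝ, E) (g • q),
      (cotangentLift g (𝒩.legendre ⟨q, v⟩)).2 w =
        𝒩.κ.inner (g • q) (mfderiv 𝓘(ℝ, E) 𝓘(ℝ, E) (fun x : Q => g • x) q v) w := by
    intro w
    obtain ⟨u, rfl⟩ : ∃ u : TangentSpace 𝓘(ℝ, E) q,
        mfderiv 𝓘(ℝ, E) 𝓘(ℝ, E) (fun x : Q => g • x) q u = w :=
      ⟨_, mfderiv_smul_mfderiv_inv_smul EG g q w⟩
    rw [h.inner_mfderiv]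
    exact cotangentLift_mfderiv_smul EG g (𝒩.legendre ⟨q, v⟩) u
  exact congrArg (TotalSpace.mk (g • q)) (ContinuousLinearMap.ext hcov)

variable [LieGroup 𝓘(ℝ, EG) ∞ G] [ContMDiffSMul 𝓘(ℝ, EG) 𝓘(ℝ, E) ∞ G Q] {k : ℕ}
  {ζ : Fin k → Q → GroupLieAlgebra 𝓘(ℝ, EG) G}

/-- Invariance of `Jᵢ` says that the difference of the two sides, which lies in `D`, is
`κ`-orthogonal to `D`. -/
theorem IsHorizontalGaugeSymmetryBasis.generator_smul (h : 𝒩.IsHorizontalGaugeSymmetryBasis ζ)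
    (hsymm : 𝒩.IsSymmetry G) (i : Fin k) (g : G) (q : Q) :
    generator (g • q) (ζ i (g • q)) =
      mfderiv 𝓘(ℝ, E) 𝓘(ℝ, E) (fun x : Q => g • x) q (generator q (ζ i q)) := by
  set A := mfderiv 𝓘(ℝ, E) 𝓘(ℝ, E) (fun x : Q => g • x) q
  set Y := generator (E := E) (g • q) (ζ i (g • q))
  set Z := generator (E := E) q (ζ i q)
  have horth : ∀ u ∈ 𝒩.D q, 𝒩.κ.inner (g • q) (A u) (Y - A Z) = 0 := by
    intro u hu
    have hinv := h.invariant i g (𝒩.legendre ⟨q, u⟩) ⟨⟨q, u⟩, hu, rfl⟩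
    rw [hsymm.cotangentLift_legendre (EG := EG), gaugeMomentum, gaugeMomentum, momentumMap_apply,
      momentumMap_apply] at hinv
    rw [map_sub, hsymm.inner_mfderiv]
    exact sub_eq_zero.2 hinv
  have hD : Y - A Z ∈ 𝒩.D (g • q) :=
    sub_mem (h.mem i (g • q)).1 ((hsymm g).2 q Z (h.mem i q).1)
  obtain ⟨u, hu, hAu⟩ := hsymm.exists_mfderiv_eq (EG := EG) g q hD
  by_contra hne
  exact (𝒩.κ.pos (g • q) (Y - A Z) (sub_ne_zero.2 hne)).ne'
    (by simpa only [A, hAu] using horth u hu)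

theorem IsHorizontalGaugeSymmetryBasis.linearIndependent_generator
    (h : 𝒩.IsHorizontalGaugeSymmetryBasis ζ) (q : Q) :
    LinearIndependent ℝ fun i => generator (E := E) q (ζ i q) := by
  refine Fintype.linearIndependent_iff.2 fun a ha =>
    congrFun (h.independent ⟨q, 0⟩ ⟨⟨q, 0⟩, (𝒩.D q).zero_mem, ?_⟩ a fun v _ => ?_)
  · simp only [legendre, map_zero]
  · obtain ⟨β, hβ⟩ := exists_forall_mfderiv_momentumFunction_zero q v
    have hdiff : ∀ i, cotangentDiff (gaugeMomentum (ζ i)) (⟨q, 0⟩ : CotangentBundle E Q) v =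
        β (generator q (ζ i q)) := fun i => by
      rw [gaugeMomentum_eq_momentumFunction]
      exact hβ _ (contMDiff_generator (h.contMDiff i))
    simpa only [hdiff, map_sum, map_smul, smul_eq_mul, map_zero] using congrArg β ha

theorem IsHorizontalGaugeSymmetryBasis.isInvariantFrame [FiniteDimensional ℝ E]
    (h : 𝒩.IsHorizontalGaugeSymmetryBasis ζ) (hsymm : 𝒩.IsSymmetry G) :
    IsInvariantFrame (fun q => 𝒩.D q ⊓ verticalSpace EG G q) ζ where
  contMDiff := h.contMDiff
  linearIndependent := h.linearIndependent_generator
  span_eq q := by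
    have : FiniteDimensional ℝ (TangentSpace 𝓘(ℝ, E) q) := inferInstanceAs (FiniteDimensional ℝ E)
    refine Submodule.eq_of_le_of_finrank_eq
      (Submodule.span_le.2 (Set.range_subset_iff.2 fun i => h.mem i q)) ?_
    rw [finrank_span_eq_card (h.linearIndependent_generator q), Fintype.card_fin, h.rank_eq]
  generator_smul := h.generator_smul hsymm

end NonholonomicSystem

/-! ### Foliation by the connected fibres of a submersion -/

section Straightening

variable {E E' V : Type*} [NormedAddCommGroup E] [NormedSpace ℝ E] [CompleteSpace E]
  [NormedAddCommGroup E'] [NormedSpace ℝ E']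
  [NormedAddCommGroup V] [NormedSpace ℝ V] [FiniteDimensional ℝ V]

/-- Unlike `ContDiffAt.toOpenPartialHomeomorph`, the local inverse is smooth on its whole domain,
which is a ball. -/
theorem exists_openPartialHomeomorph_contDiffOn {Φ : E → E'} {U : Set E} {z : E}
    {A : E ≃L[ℝ] E'} (hU : IsOpen U) (hz : z ∈ U) (hΦ : ContDiffOn ℝ ∞ Φ U)
    (hA : HasFDerivAt Φ (A : E →L[ℝ] E') z) :
    ∃ Ψ : OpenPartialHomeomorph E E', ⇑Ψ = Φ ∧ z ∈ Ψ.source ∧ Ψ.source ⊆ U ∧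
      ContDiffOn ℝ ∞ Ψ.symm Ψ.target ∧ Convex ℝ Ψ.target := by
  have hΦ' : ∀ y ∈ U, ContDiffAt ℝ ∞ Φ y := fun y hy => hΦ.contDiffAt (hU.mem_nhds hy)
  let Θ := (hΦ' z hz).toOpenPartialHomeomorph Φ hA (by simp)
  have hzΘ : z ∈ Θ.source := (hΦ' z hz).mem_toOpenPartialHomeomorph_source hA (by simp)
  let R := U ∩ fderiv ℝ Φ ⁻¹' Set.range ((↑) : (E ≃L[ℝ] E') → E →L[ℝ] E')
  have hR : IsOpen R := (hΦ.continuousOn_fderiv_of_isOpen hU (by simp)).isOpen_inter_preimage hU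
    ContinuousLinearEquiv.isOpen
  have hzR : z ∈ R := ⟨hz, A, hA.fderiv.symm⟩
  obtain ⟨ε, hε, hball⟩ := Metric.isOpen_iff.1 (Θ.symm.isOpen_inter_preimage hR) (Θ z)
    ⟨Θ.map_source hzΘ, by rwa [Set.mem_preimage, Θ.left_inv hzΘ]⟩
  let Ψ := (Θ.symm.restrOpen (Metric.ball (Θ z) ε) Metric.isOpen_ball).symm
  have htarget : Ψ.target = Metric.ball (Θ z) ε :=
    Set.inter_eq_right.2 fun y hy => (hball hy).1
  have hsymm : ∀ y ∈ Ψ.target, Ψ.symm y ∈ R := fun y hy => (hball (htarget ▸ hy)).2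
  refine ⟨Ψ, rfl, ?_, fun y hy => ?_, fun y hy => ?_, htarget ▸ convex_ball _ _⟩
  · have hΨz : Ψ.symm (Θ z) ∈ Ψ.source := Ψ.map_target (htarget ▸ Metric.mem_ball_self hε)
    rwa [show Ψ.symm (Θ z) = z from Θ.left_inv hzΘ] at hΨz
  · rw [← Ψ.left_inv hy]
    exact (hsymm _ (Ψ.map_source hy)).1
  · obtain ⟨hyU, B, hB⟩ := hsymm y hy
    refine (Ψ.contDiffAt_symm hy (f₀' := B) ?_ (hΦ' _ hyU)).contDiffWithinAt
    rw [hB]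
    exact ((hΦ' _ hyU).differentiableAt (by simp)).hasFDerivAt

/-- With `s` a right inverse of `p = f'(z)`, the map `y ↦ y - s (p y) + s (f y)` has the identity
as derivative at `z`, and `p` takes it to `f`. -/
theorem exists_straightening {f : E → V} {U : Set E} {z : E} (hU : IsOpen U) (hz : z ∈ U)
    (hf : ContDiffOn ℝ ∞ f U) (hs : Function.Surjective (fderiv ℝ f z)) :
    ∃ Ψ : OpenPartialHomeomorph E E, z ∈ Ψ.source ∧ Ψ.source ⊆ U ∧
      ContDiffOn ℝ ∞ Ψ Ψ.source ∧ ContDiffOn ℝ ∞ Ψ.symm Ψ.target ∧ Convex ℝ Ψ.target ∧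
      ∀ y, fderiv ℝ f z (Ψ y) = f y := by
  set p := fderiv ℝ f z
  obtain ⟨s, hs⟩ : ∃ s : V →L[ℝ] E, ∀ v, p (s v) = v := by
    obtain ⟨s, hs⟩ := p.toLinearMap.exists_rightInverse_of_surjective (LinearMap.range_eq_top.2 hs)
    exact ⟨LinearMap.toContinuousLinearMap s, LinearMap.congr_fun hs⟩
  let Φ : E → E := fun y => y - s (p y) + s (f y)
  have hΦ : ContDiffOn ℝ ∞ Φ U := by fun_prop
  have hfz : HasFDerivAt f p z :=
    ((hf.contDiffAt (hU.mem_nhds hz)).differentiableAt (by simp)).hasFDerivAt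
  have hΦz : HasFDerivAt Φ (ContinuousLinearEquiv.refl ℝ E : E →L[ℝ] E) z := by
    refine (((hasFDerivAt_id z).sub (s.hasFDerivAt.comp z p.hasFDerivAt)).add
      (s.hasFDerivAt.comp z hfz)).congr_fderiv ?_
    ext v
    simp
  obtain ⟨Ψ, hΨ, hzΨ, hΨU, hΨsymm, hconv⟩ := exists_openPartialHomeomorph_contDiffOn hU hz hΦ hΦz
  refine ⟨Ψ, hzΨ, hΨU, hΨ ▸ hΦ.mono hΨU, hΨsymm, hconv, fun y => ?_⟩
  simp only [hΨ, Φ, map_add, map_sub, hs, sub_self, zero_add]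

end Straightening

section FlatChart

variable {E H M V : Type*} [NormedAddCommGroup E] [NormedSpace ℝ E]
  [NormedAddCommGroup V] [NormedSpace ℝ V]
  [TopologicalSpace H] {I : ModelWithCorners ℝ E H} [TopologicalSpace M] [ChartedSpace H M]

theorem exists_mem_maximalAtlas_extend_eq [I.Boundaryless] [IsManifold I ∞ M] (x : M)
    (Ψ : OpenPartialHomeomorph E E) (hsource : Ψ.source ⊆ (extChartAt I x).target)
    (hΨ : ContDiffOn ℝ ∞ Ψ Ψ.source) (hΨsymm : ContDiffOn ℝ ∞ Ψ.symm Ψ.target) :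
    ∃ φ ∈ IsManifold.maximalAtlas I ∞ M,
      φ.source = (extChartAt I x).source ∩ extChartAt I x ⁻¹' Ψ.source ∧
      (φ.extend I).target = Ψ.target ∧ ∀ y, φ.extend I y = Ψ (extChartAt I x y) := by
  let h := I.toHomeomorph
  let φ : OpenPartialHomeomorph M H :=
    (((chartAt H x).trans h.toOpenPartialHomeomorph).trans Ψ).trans h.symm.toOpenPartialHomeomorph
  have hφsource : φ.source = (extChartAt I x).source ∩ extChartAt I x ⁻¹' Ψ.source := by
    ext y
    simp [φ, h]
  have hφtarget : (φ.extend I).target = Ψ.target := by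
    ext z
    have hz : z ∈ (φ.extend I).target ↔ z ∈ Ψ.target ∧ Ψ.symm z ∈ (extChartAt I x).target := by
      simp [φ, h, extChartAt, I.range_eq_univ]
    rw [hz, and_iff_left_iff_imp]
    exact fun hz => hsource (Ψ.map_target hz)
  refine ⟨φ, φ.mem_maximalAtlas_of_contMDiffOn ?_ ?_, hφsource, hφtarget,
    fun y => I.right_inv' (by simp [I.range_eq_univ])⟩
  · refine I.contMDiffOn_symm.comp ((contMDiffOn_iff_contDiffOn.2 hΨ).comp
      (contMDiffOn_extChartAt.mono ?_) fun y hy => (hφsource ▸ hy).2)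
      fun y _ => by simp [I.range_eq_univ]
    rw [hφsource, extChartAt_source]
    exact Set.inter_subset_left
  · have hmaps : ∀ z ∈ φ.target, I z ∈ Ψ.target := fun z hz => by
      rw [← hφtarget]
      simpa using hz
    exact (contMDiffOn_extChartAt_symm x).comp ((contMDiffOn_iff_contDiffOn.2 hΨsymm).comp
      (I.contMDiff (n := ∞)).contMDiffOn hmaps) fun z hz => hsource (Ψ.map_target (hmaps z hz))

/-- `φ` is a chart of the smooth atlas, with convex image, in which `f : M → V` is the surjective
linear map `p`: a flat chart of the foliation of `M` by the connected fibres of `f`. -/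
structure IsFlatChart (I : ModelWithCorners ℝ E H) (f : M → V) (φ : OpenPartialHomeomorph M H)
    (p : E →L[ℝ] V) : Prop where
  mem_maximalAtlas : φ ∈ IsManifold.maximalAtlas I ∞ M
  convex_target : Convex ℝ (φ.extend I).target
  surjective : Function.Surjective p
  apply_eq : ∀ y ∈ φ.source, p (φ.extend I y) = f y

theorem exists_isFlatChart [CompleteSpace E] [FiniteDimensional ℝ V] [I.Boundaryless]
    [IsManifold I ∞ M] {f : M → V} (hf : ContMDiff I 𝓘(ℝ, V) ∞ f) (x : M)
    (hs : Function.Surjective (mfderiv I 𝓘(ℝ, V) f x)) :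
    ∃ φ p, IsFlatChart I f φ p ∧ x ∈ φ.source := by
  set e := extChartAt I x
  have hfe : ContDiffOn ℝ ∞ (f ∘ e.symm) e.target :=
    contMDiffOn_iff_contDiffOn.1 (hf.comp_contMDiffOn (contMDiffOn_extChartAt_symm x))
  have hderiv : Function.Surjective (fderiv ℝ (f ∘ e.symm) (e x)) := by
    rwa [((hf x).mdifferentiableAt (by simp)).mfderiv, I.range_eq_univ, fderivWithin_univ] at hs
  obtain ⟨Ψ, hxΨ, hΨe, hΨ, hΨsymm, hconv, hp⟩ :=
    exists_straightening (isOpen_extChartAt_target x) (mem_extChartAt_target x) hfe hderiv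
  obtain ⟨φ, hφ, hφsource, hφtarget, hφΨ⟩ :=
    exists_mem_maximalAtlas_extend_eq x Ψ hΨe hΨ hΨsymm
  refine ⟨φ, _, ⟨hφ, hφtarget ▸ hconv, hderiv, fun y hy => ?_⟩,
    hφsource ▸ ⟨mem_extChartAt_source x, hxΨ⟩⟩
  rw [hφΨ, hp]
  exact congrArg f (e.left_inv (hφsource ▸ hy).1)

theorem IsFlatChart.joinedIn_fiber {f : M → V} {φ : OpenPartialHomeomorph M H} {p : E →L[ℝ] V}
    (h : IsFlatChart I f φ p) {y z : M} (hy : y ∈ φ.source) (hz : z ∈ φ.source)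
    (hyz : f z = f y) : JoinedIn (f ⁻¹' {f y}) y z := by
  let e := φ.extend I
  have he : ∀ w ∈ φ.source, w ∈ e.source := fun w hw => φ.extend_source (I := I) ▸ hw
  let T : Set E := e.target ∩ p ⁻¹' {f y}
  have hT : Convex ℝ T := h.convex_target.inter ((convex_singleton _).linear_preimage p.toLinearMap)
  have heT : ∀ w ∈ φ.source, f w = f y → e w ∈ T := fun w hw hfw =>
    ⟨e.map_source (he w hw), (h.apply_eq w hw).trans hfw⟩
  have hpath : IsPathConnected (e.symm '' T) :=
    (hT.isPathConnected ⟨_, heT y hy rfl⟩).image'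
      ((φ.continuousOn_extend_symm (I := I)).mono Set.inter_subset_left)
  have hmem : ∀ w ∈ φ.source, f w = f y → w ∈ e.symm '' T := fun w hw hfw =>
    ⟨e w, heT w hw hfw, e.left_inv (he w hw)⟩
  refine (hpath.joinedIn y (hmem y hy rfl) z (hmem z hz hyz)).mono ?_
  rintro _ ⟨w, ⟨hw, hpw⟩, rfl⟩
  have hew : e.symm w ∈ φ.source := φ.extend_source (I := I) ▸ e.map_target hw
  exact (h.apply_eq _ hew).symm.trans ((congrArg p (e.right_inv hw)).trans hpw)

theorem isEmbeddedSubmanifold_fiber {k : ℕ} [CompleteSpace E] [I.Boundaryless] [IsManifold I ∞ M]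
    {f : M → Fin k → ℝ} (hf : ContMDiff I 𝓘(ℝ, Fin k → ℝ) ∞ f)
    (hs : ∀ x, Function.Surjective (mfderiv I 𝓘(ℝ, Fin k → ℝ) f x)) (c : Fin k → ℝ) :
    IsEmbeddedSubmanifold I (f ⁻¹' {c}) k := by
  rintro x rfl
  obtain ⟨φ, p, hφ, hx⟩ := exists_isFlatChart hf x (hs x)
  refine ⟨φ, hφ.mem_maximalAtlas, hx, p, hφ.surjective, fun y hy => ?_⟩
  rw [hφ.apply_eq y hy, hφ.apply_eq x hx, Set.mem_preimage, Set.mem_singleton_iff]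

end FlatChart

section ConnectedFibers

variable {M X : Type*} [TopologicalSpace M]

theorem joinedIn_connectedComponentIn {S : Set M} {x y : M} (h : JoinedIn S x y) :
    JoinedIn (connectedComponentIn S x) x y := by
  obtain ⟨γ, hγ⟩ := h
  exact ⟨γ, fun t => (isPreconnected_range γ.continuous).subset_connectedComponentIn
    ⟨0, γ.source⟩ (Set.range_subset_iff.2 hγ) ⟨t, rfl⟩⟩

theorem isPathConnected_connectedComponentIn {S : Set M} {x : M} (hx : x ∈ S)
    (h : ∀ a ∈ S, ∀ᶠ b in 𝓝[S] a, JoinedIn S a b) :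
    IsPathConnected (connectedComponentIn S x) := by
  have hxS := mem_connectedComponentIn hx
  refine ⟨x, hxS, fun {y} hy => isPreconnected_connectedComponentIn.induction₂
    (JoinedIn (connectedComponentIn S x)) (fun a ha => ?_)
    (fun a b c _ _ _ => JoinedIn.trans) (fun a b _ _ => JoinedIn.symm) hxS hy⟩
  filter_upwards [nhdsWithin_mono a (connectedComponentIn_subset S x)
    (h a (connectedComponentIn_subset S x ha))] with b hab
  rw [connectedComponentIn_eq ha]
  exact joinedIn_connectedComponentIn hab

theorem isPartition_connectedComponentIn_fiber (f : M → X) :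
    Setoid.IsPartition (Set.range fun x => connectedComponentIn (f ⁻¹' {f x}) x) := by
  have hmem : ∀ x, x ∈ connectedComponentIn (f ⁻¹' {f x}) x := fun x => mem_connectedComponentIn rfl
  refine ⟨?_, fun x => ⟨_, ⟨⟨x, rfl⟩, hmem x⟩, ?_⟩⟩
  · rintro ⟨x, hx⟩
    exact (hx ▸ hmem x : x ∈ (∅ : Set M))
  · rintro L ⟨⟨y, rfl⟩, hxy⟩
    have hfx : f x = f y := connectedComponentIn_subset (f ⁻¹' {f y}) y hxy
    simp only [hfx]
    exact connectedComponentIn_eq hxy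

end ConnectedFibers

section Foliation

variable {E H M : Type*} [NormedAddCommGroup E] [NormedSpace ℝ E]
  [TopologicalSpace H] {I : ModelWithCorners ℝ E H} [TopologicalSpace M] [ChartedSpace H M]

theorem IsFlatChart.exists_countable_slices {V : Type*} [NormedAddCommGroup V] [NormedSpace ℝ V]
    {f : M → V} {φ : OpenPartialHomeomorph M H} {p : E →L[ℝ] V} (h : IsFlatChart I f φ p) (x : M) :
    ∃ C : Set V, C.Countable ∧
      ∀ y ∈ φ.source, y ∈ connectedComponentIn (f ⁻¹' {f x}) x ↔ p (φ.extend I y) ∈ C := by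
  have hf : ∀ y ∈ connectedComponentIn (f ⁻¹' {f x}) x, f y = f x :=
    fun _ hy => connectedComponentIn_subset (f ⁻¹' {f x}) x hy
  by_cases hφ : ∃ b ∈ φ.source, b ∈ connectedComponentIn (f ⁻¹' {f x}) x
  · obtain ⟨b, hb, hbx⟩ := hφ
    refine ⟨{f x}, Set.countable_singleton _, fun y hy => ?_⟩
    rw [h.apply_eq y hy, Set.mem_singleton_iff]
    refine ⟨hf y, fun hyx => ?_⟩
    rw [connectedComponentIn_eq hbx, ← hf b hbx]
    exact (joinedIn_connectedComponentIn
      (h.joinedIn_fiber hb hy (hyx.trans (hf b hbx).symm))).target_mem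
  · exact ⟨∅, Set.countable_empty, fun y hy => iff_of_false (fun hyx => hφ ⟨y, hy, hyx⟩) id⟩

variable [CompleteSpace E] [I.Boundaryless] [IsManifold I ∞ M] {k : ℕ}

theorem isFoliation_connectedComponentIn_fiber {f : M → Fin k → ℝ}
    (hf : ContMDiff I 𝓘(ℝ, Fin k → ℝ) ∞ f)
    (hs : ∀ x, Function.Surjective (mfderiv I 𝓘(ℝ, Fin k → ℝ) f x)) :
    IsFoliation I (Set.range fun x => connectedComponentIn (f ⁻¹' {f x}) x) k where
  partition := isPartition_connectedComponentIn_fiber f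
  isPathConnected := by
    rintro _ ⟨x, rfl⟩
    refine isPathConnected_connectedComponentIn rfl fun a ha => ?_
    obtain ⟨φ, p, hφ, haφ⟩ := exists_isFlatChart hf a (hs a)
    filter_upwards [mem_nhdsWithin_of_mem_nhds (φ.open_source.mem_nhds haφ),
      self_mem_nhdsWithin] with b hb hbx
    rw [← show f a = f x from ha]
    exact hφ.joinedIn_fiber haφ hb (hbx.trans ha.symm)
  flat_chart x := by
    obtain ⟨φ, p, hφ, hx⟩ := exists_isFlatChart hf x (hs x)
    refine ⟨φ, hφ.mem_maximalAtlas, hx, hφ.convex_target, p, hφ.surjective, ?_⟩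
    rintro _ ⟨a, rfl⟩
    exact hφ.exists_countable_slices a

end Foliation

/-! ### Level sets of the momentum map -/

section DualFrame

variable {X V : Type*} [AddCommGroup V] [Module ℝ V] {k : ℕ} {η : Fin k → X → V} {x : X}

theorem dualFrame_apply (hi : LinearIndependent ℝ fun j => η j x)
    (hs : ⊤ ≤ Submodule.span ℝ (Set.range fun j => η j x)) (i j : Fin k) :
    dualFrame η i x (η j x) = if i = j then 1 else 0 := by
  rw [dualFrame, dif_pos ⟨hi, hs⟩, Module.Basis.mk_coord_apply]
  exact if_congr eq_comm rfl rfl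

theorem eq_sum_smul_dualFrame_iff (hi : LinearIndependent ℝ fun j => η j x)
    (hs : ⊤ ≤ Submodule.span ℝ (Set.range fun j => η j x)) (c : Fin k → ℝ)
    (φ : Module.Dual ℝ V) :
    φ = (∑ i, c i • dualFrame η i) x ↔ ∀ j, φ (η j x) = c j := by
  have hvalue : ∀ j, (∑ i, c i • dualFrame η i) x (η j x) = c j := fun j => by
    simp [Finset.sum_apply, LinearMap.sum_apply, dualFrame_apply hi hs]
  refine ⟨fun h j => h ▸ hvalue j, fun h => (Module.Basis.mk hi hs).ext fun j => ?_⟩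
  rw [Module.Basis.mk_apply, h, hvalue]

end DualFrame

theorem exists_continuousLinearMap_apply_eq {ι V : Type*} [Finite ι] [NormedAddCommGroup V]
    [NormedSpace ℝ V] {v : ι → V} (hv : LinearIndependent ℝ v) (r : ι → ℝ) :
    ∃ β : V →L[ℝ] ℝ, ∀ i, β (v i) = r i := by
  let b := Module.Basis.span hv
  have := Module.Finite.of_basis b
  obtain ⟨β, hβ, -⟩ := exists_extension_norm_eq _ (b.constr ℝ r).toContinuousLinearMap
  refine ⟨β, fun i => ?_⟩
  have hi := hβ (b i)
  rwa [LinearMap.coe_toContinuousLinearMap', Module.Basis.constr_basis,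
    Module.Basis.span_apply] at hi

theorem mfderiv_pi_apply {ι E H M V : Type*} [Fintype ι] [NormedAddCommGroup E] [NormedSpace ℝ E]
    [TopologicalSpace H] {I : ModelWithCorners ℝ E H} [TopologicalSpace M] [ChartedSpace H M]
    [NormedAddCommGroup V] [NormedSpace ℝ V] {f : M → ι → V} {x : M}
    (hf : MDifferentiableAt I 𝓘(ℝ, ι → V) f x) (v : TangentSpace I x) (i : ι) :
    (mfderiv I 𝓘(ℝ, ι → V) f x v : ι → V) i = mfderiv I 𝓘(ℝ, V) (fun y => f y i) x v := by
  have hi := HasMFDerivAt.comp x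
    (ContinuousLinearMap.proj (R := ℝ) (φ := fun _ : ι => V) i).hasMFDerivAt hf.hasMFDerivAt
  exact (DFunLike.congr_fun hi.mfderiv v).symm

/-- The map `(J_{η₁}, …, J_{ηₖ}) : T*X → ℝᵏ` of the gauge momenta of `η₁, …, ηₖ`. -/
noncomputable def gaugeMomenta {EF F E X : Type*} [NormedAddCommGroup EF] [NormedSpace ℝ EF]
    [TopologicalSpace F] [ChartedSpace EF F] [Group F] [NormedAddCommGroup E] [NormedSpace ℝ E]
    [TopologicalSpace X] [ChartedSpace E X] [IsManifold 𝓘(ℝ, E) ∞ X] [MulAction F X] {k : ℕ}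
    (η : Fin k → X → GroupLieAlgebra 𝓘(ℝ, EF) F) (α : CotangentBundle E X) (i : Fin k) : ℝ :=
  gaugeMomentum (η i) α

section GaugeMomenta

variable {EF F E X : Type*} [NormedAddCommGroup EF] [NormedSpace ℝ EF] [TopologicalSpace F]
  [ChartedSpace EF F] [Group F] [LieGroup 𝓘(ℝ, EF) ∞ F] [NormedAddCommGroup E] [NormedSpace ℝ E]
  [TopologicalSpace X] [ChartedSpace E X] [IsManifold 𝓘(ℝ, E) ∞ X] [MulAction F X]
  [ContMDiffSMul 𝓘(ℝ, EF) 𝓘(ℝ, E) ∞ F X] {k : ℕ} {η : Fin k → X → GroupLieAlgebra 𝓘(ℝ, EF) F}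

theorem contMDiff_gaugeMomenta (hη : ∀ i, ContMDiff (M' := EF) 𝓘(ℝ, E) 𝓘(ℝ, EF) ∞ (η i)) :
    ContMDiff (cotangentModel E) 𝓘(ℝ, Fin k → ℝ) ∞ (gaugeMomenta (E := E) η) :=
  contMDiff_pi_space.2 fun i => by
    simp only [gaugeMomenta, gaugeMomentum_eq_momentumFunction]
    exact contMDiff_momentumFunction (contMDiff_generator (hη i))

/-- Along the fibre of `T*X` the derivative is the pairing with the independent vectors
`(ηᵢ(x))_X(x)`. -/
theorem surjective_mfderiv_gaugeMomenta
    (hη : ∀ i, ContMDiff (M' := EF) 𝓘(ℝ, E) 𝓘(ℝ, EF) ∞ (η i)) (α : CotangentBundle E X)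
    (hind : LinearIndependent ℝ fun i => generator (E := E) α.proj (η i α.proj)) :
    Function.Surjective
      (mfderiv (cotangentModel E) 𝓘(ℝ, Fin k → ℝ) (gaugeMomenta (E := E) η) α) := by
  intro r
  obtain ⟨β, hβ⟩ := exists_continuousLinearMap_apply_eq (V := E) hind r
  obtain ⟨w, hw⟩ := exists_forall_mfderiv_momentumFunction α β
  refine ⟨w, funext fun i => (mfderiv_pi_apply
    ((contMDiff_gaugeMomenta hη).mdifferentiableAt (by simp)) w i).trans ?_⟩
  rw [show (fun γ => gaugeMomenta η γ i) = _ from gaugeMomentum_eq_momentumFunction (η i)]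
  exact (hw _ (contMDiff_generator (hη i))).trans (hβ i)

end GaugeMomenta

namespace IsInvariantFrame

variable {EF F E X : Type*} [NormedAddCommGroup EF] [NormedSpace ℝ EF] [TopologicalSpace F]
  [ChartedSpace EF F] [Group F] [NormedAddCommGroup E] [NormedSpace ℝ E] [TopologicalSpace X]
  [ChartedSpace E X] [IsManifold 𝓘(ℝ, E) ∞ X] [MulAction F X] {k : ℕ}
  {η : Fin k → X → GroupLieAlgebra 𝓘(ℝ, EF) F}
  {S : ∀ x : X, Submodule ℝ (TangentSpace 𝓘(ℝ, E) x)}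

theorem linearIndependent_apply (h : IsInvariantFrame S η) (x : X) :
    LinearIndependent ℝ fun i => η i x :=
  .of_comp (generator (E := E) x).toLinearMap (h.linearIndependent x)

theorem top_le_span (h : IsInvariantFrame (verticalSpace (E := E) EF F) η)
    (hinj : ∀ x : X, Function.Injective (generator (EG := EF) (G := F) (E := E) x)) (x : X) :
    ⊤ ≤ Submodule.span ℝ (Set.range fun i => η i x) := by
  refine (Submodule.map_le_map_iff_of_injective (f := (generator (E := E) x).toLinearMap)
    (hinj x) _ _).1 ?_
  rw [Submodule.map_span, ← Set.range_comp, Submodule.map_top]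
  exact (h.span_eq x).ge

theorem momentumLevelSet_eq_preimage (h : IsInvariantFrame (verticalSpace (E := E) EF F) η)
    (hinj : ∀ x : X, Function.Injective (generator (EG := EF) (G := F) (E := E) x))
    (c : Fin k → ℝ) :
    momentumLevelSet (E := E) (∑ i, c i • dualFrame η i) = gaugeMomenta η ⁻¹' {c} :=
  Set.ext fun α => (eq_sum_smul_dualFrame_iff (h.linearIndependent_apply α.proj)
    (h.top_le_span hinj α.proj) c (momentumMap α)).trans funext_iff.symm

theorem momentumLevelSet_eq_iInter (h : IsInvariantFrame (verticalSpace (E := E) EF F) η)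
    (hinj : ∀ x : X, Function.Injective (generator (EG := EF) (G := F) (E := E) x))
    (c : Fin k → ℝ) :
    momentumLevelSet (E := E) (∑ i, c i • dualFrame η i) =
      ⋂ i, {α : CotangentBundle E X | gaugeMomentum (η i) α = c i} := by
  rw [h.momentumLevelSet_eq_preimage hinj]
  exact Set.ext fun α => funext_iff.trans (Set.mem_iInter (s := fun i => {α | _ = c i})).symm

theorem leaves_eq_range (h : IsInvariantFrame (verticalSpace (E := E) EF F) η)
    (hinj : ∀ x : X, Function.Injective (generator (EG := EF) (G := F) (E := E) x)) :
    {L : Set (CotangentBundle E X) | ∃ ν ∈ Submodule.span ℝ (Set.range (dualFrame η)),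
      ∃ α ∈ momentumLevelSet (E := E) ν, L = connectedComponentIn (momentumLevelSet ν) α} =
    Set.range fun α => connectedComponentIn (gaugeMomenta η ⁻¹' {gaugeMomenta η α}) α := by
  ext L
  constructor
  · rintro ⟨ν, hν, α, hα, rfl⟩
    obtain ⟨c, rfl⟩ := (Submodule.mem_span_range_iff_exists_fun ℝ).1 hν
    rw [h.momentumLevelSet_eq_preimage hinj] at hα ⊢
    obtain rfl : gaugeMomenta η α = c := hα
    exact ⟨α, rfl⟩
  · rintro ⟨α, rfl⟩
    refine ⟨∑ i, gaugeMomenta η α i • dualFrame η i,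
      (Submodule.mem_span_range_iff_exists_fun ℝ).2 ⟨_, rfl⟩, α, ?_⟩
    rw [h.momentumLevelSet_eq_preimage hinj]
    exact ⟨rfl, rfl⟩

variable [LieGroup 𝓘(ℝ, EF) ∞ F] [ContMDiffSMul 𝓘(ℝ, EF) 𝓘(ℝ, E) ∞ F X]

theorem gaugeMomentum_cotangentLift (h : IsInvariantFrame S η) (i : Fin k) (f : F)
    (α : CotangentBundle E X) :
    gaugeMomentum (η i) (cotangentLift f α) = gaugeMomentum (η i) α := by
  simp only [gaugeMomentum_eq_momentumFunction]
  refine Eq.trans ?_ (cotangentLift_mfderiv_smul EF f α _)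
  exact congrArg (cotangentLift f α).2 (h.generator_smul i f α.proj)

theorem cotangentLift_mem_momentumLevelSet
    (h : IsInvariantFrame (verticalSpace (E := E) EF F) η)
    (hinj : ∀ x : X, Function.Injective (generator (EG := EF) (G := F) (E := E) x))
    (c : Fin k → ℝ) (f : F) {α : CotangentBundle E X}
    (hα : α ∈ momentumLevelSet (E := E) (∑ i, c i • dualFrame η i)) :
    cotangentLift f α ∈ momentumLevelSet (E := E) (∑ i, c i • dualFrame η i) := by
  rw [h.momentumLevelSet_eq_iInter hinj, Set.mem_iInter] at hα ⊢
  exact fun i => (h.gaugeMomentum_cotangentLift i f α).trans (hα i)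

variable [CompleteSpace E]

theorem isEmbeddedSubmanifold_momentumLevelSet
    (h : IsInvariantFrame (verticalSpace (E := E) EF F) η)
    (hinj : ∀ x : X, Function.Injective (generator (EG := EF) (G := F) (E := E) x))
    (c : Fin k → ℝ) :
    IsEmbeddedSubmanifold (cotangentModel E)
      (momentumLevelSet (E := E) (∑ i, c i • dualFrame η i)) k := by
  rw [h.momentumLevelSet_eq_preimage hinj]
  exact isEmbeddedSubmanifold_fiber (contMDiff_gaugeMomenta h.contMDiff)
    (fun α => surjective_mfderiv_gaugeMomenta h.contMDiff α (h.linearIndependent α.proj)) c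

theorem isFoliation_momentumLevelSet (h : IsInvariantFrame (verticalSpace (E := E) EF F) η)
    (hinj : ∀ x : X, Function.Injective (generator (EG := EF) (G := F) (E := E) x)) :
    IsFoliation (cotangentModel E)
      {L : Set (CotangentBundle E X) | ∃ ν ∈ Submodule.span ℝ (Set.range (dualFrame η)),
        ∃ α ∈ momentumLevelSet (E := E) ν, L = connectedComponentIn (momentumLevelSet ν) α} k := by
  rw [h.leaves_eq_range hinj]
  exact isFoliation_connectedComponentIn_fiber (contMDiff_gaugeMomenta h.contMDiff)
    fun α => surjective_mfderiv_gaugeMomenta h.contMDiff α (h.linearIndependent α.proj)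

end IsInvariantFrame

namespace NonholonomicSystem

theorem VerticalSymmetryCondition.inf_verticalSpace_sup {E Q EG G : Type*} [NormedAddCommGroup E]
    [NormedSpace ℝ E] [TopologicalSpace Q] [ChartedSpace E Q] [IsManifold 𝓘(ℝ, E) ∞ Q]
    [NormedAddCommGroup EG] [NormedSpace ℝ EG] [TopologicalSpace G] [ChartedSpace EG G] [Group G]
    [MulAction G Q] {𝒩 : NonholonomicSystem E Q} {W : ∀ q : Q, Submodule ℝ (TangentSpace 𝓘(ℝ, E) q)}
    {GW : Subgroup G} (h : 𝒩.VerticalSymmetryCondition EG W GW) (q : Q) :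
    𝒩.D q ⊓ verticalSpace EG G q ⊔ W q = verticalSpace EG G q := by
  rw [inf_comm, inf_sup_assoc_of_le _ (h.le_vertical q), (h.isCompl q).sup_eq_top, inf_top_eq]

end NonholonomicSystem

theorem proposition3p1_general
    {E Q EG G E' Q' EF F : Type*}
    [NormedAddCommGroup E] [NormedSpace ℝ E] [TopologicalSpace Q] [ChartedSpace E Q]
    [IsManifold 𝓘(ℝ, E) ∞ Q]
    [NormedAddCommGroup EG] [NormedSpace ℝ EG] [TopologicalSpace G] [ChartedSpace EG G]
    [Group G] [LieGroup 𝓘(ℝ, EG) ∞ G]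
    [MulAction G Q] [ContMDiffSMul 𝓘(ℝ, EG) 𝓘(ℝ, E) ∞ G Q]
    (hfree : ∀ (g : G) (q : Q), g • q = q → g = 1)
    {S W : ∀ q : Q, Submodule ℝ (TangentSpace 𝓘(ℝ, E) q)} {GW : Subgroup G}
    (hSW : ∀ q, Disjoint (S q) (W q)) (hV : ∀ q, S q ⊔ W q = verticalSpace EG G q)
    (hW : ∀ q, (W q : Set (TangentSpace 𝓘(ℝ, E) q)) =
      tangentVectors 𝓘(ℝ, E) (MulAction.orbit GW q) q)
    {k : ℕ} {ζ : Fin k → Q → GroupLieAlgebra 𝓘(ℝ, EG) G} (hζ : IsInvariantFrame S ζ)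
    [NormedAddCommGroup E'] [NormedSpace ℝ E'] [CompleteSpace E']
    [TopologicalSpace Q'] [ChartedSpace E' Q'] [IsManifold 𝓘(ℝ, E') ∞ Q']
    [NormedAddCommGroup EF] [NormedSpace ℝ EF] [CompleteSpace EF]
    [TopologicalSpace F] [ChartedSpace EF F] [Group F] [LieGroup 𝓘(ℝ, EF) ∞ F]
    [MulAction F Q'] {ρ : Q → Q'} {pr : G →* F}
    (hred : IsReduction (EG := EG) (E := E) (EF := EF) (E' := E') GW ρ pr) :
    let η : Fin k → Q' → GroupLieAlgebra 𝓘(ℝ, EF) F :=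
      fun i => reducedSymmetry pr hred.surjective_base (ζ i)
    let μ : Fin k → Q' → Module.Dual ℝ (GroupLieAlgebra 𝓘(ℝ, EF) F) := dualFrame η
    (∀ i q, η i (ρ q) = lieProjection pr (ζ i q)) ∧
    (∀ i j x, μ i x (η j x) = if i = j then 1 else 0) ∧
    (∀ c : Fin k → ℝ,
      momentumLevelSet (E := E') (∑ i, c i • μ i) =
        ⋂ i, {α : CotangentBundle E' Q' | gaugeMomentum (η i) α = c i} ∧
      (∀ h : F, ∀ α ∈ momentumLevelSet (E := E') (∑ i, c i • μ i),
        cotangentLift h α ∈ momentumLevelSet (E := E') (∑ i, c i • μ i)) ∧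
      IsEmbeddedSubmanifold (cotangentModel E')
        (momentumLevelSet (E := E') (∑ i, c i • μ i)) k) ∧
    IsFoliation (cotangentModel E')
      {L : Set (CotangentBundle E' Q') | ∃ ν ∈ Submodule.span ℝ (Set.range μ),
        ∃ α ∈ momentumLevelSet (E := E') ν,
          L = connectedComponentIn (momentumLevelSet (E := E') ν) α} k := by
  intro η μ
  have hsmul := hred.contMDiffSMul
  have hinj : ∀ x : Q', Function.Injective (generator (EG := EF) (G := F) (E := E') x) :=
    fun x => generator_injective (hred.eq_one_of_smul_eq_self hfree x)
  have hη : ∀ i q, η i (ρ q) = lieProjection pr (ζ i q) := hred.reducedSymmetry_apply hinj hζ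
  have hframe : IsInvariantFrame (verticalSpace EF F) η := hred.isInvariantFrame hζ hSW hV hW hη
  exact ⟨hη,
    fun i j x => dualFrame_apply (hframe.linearIndependent_apply x) (hframe.top_le_span hinj x) i j,
    fun c => ⟨hframe.momentumLevelSet_eq_iInter hinj c,
      fun f _ hα => hframe.cotangentLift_mem_momentumLevelSet hinj c f hα,
      hframe.isEmbeddedSubmanifold_momentumLevelSet hinj c⟩,
    hframe.isFoliation_momentumLevelSet hinj⟩

theorem proposition3p1
    {E Q EG G E' Q' EF F : Type*}
    -- the configuration manifold `Q`
    [NormedAddCommGroup E] [NormedSpace ℝ E] [FiniteDimensional ℝ E]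
    [TopologicalSpace Q] [T2Space Q] [SecondCountableTopology Q] [ChartedSpace E Q]
    [IsManifold 𝓘(ℝ, E) ∞ Q]
    -- the Lie group `G`, acting smoothly, properly and freely on `Q`
    [NormedAddCommGroup EG] [NormedSpace ℝ EG] [FiniteDimensional ℝ EG]
    [TopologicalSpace G] [T2Space G] [SecondCountableTopology G] [ChartedSpace EG G]
    [Group G] [LieGroup 𝓘(ℝ, EG) ∞ G]
    [MulAction G Q] [ContMDiffSMul 𝓘(ℝ, EG) 𝓘(ℝ, E) ∞ G Q] [ProperSMul G Q]
    (hfree : ∀ (g : G) (q : Q), g • q = q → g = 1)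
    -- the nonholonomic system with its symmetry
    (𝒩 : NonholonomicSystem E Q) (hsymm : 𝒩.IsSymmetry G)
    (hdim : 𝒩.DimensionAssumption EG G)
    (W : ∀ q : Q, Submodule ℝ (TangentSpace 𝓘(ℝ, E) q)) (GW : Subgroup G)
    (hW : 𝒩.VerticalSymmetryCondition EG W GW)
    -- the horizontal gauge symmetries
    {k : ℕ} (ζ : Fin k → Q → GroupLieAlgebra 𝓘(ℝ, EG) G)
    (hζ : 𝒩.IsHorizontalGaugeSymmetryBasis ζ)
    -- the reduced manifold `Q' = Q / G_W` and the group `F = G / G_W` acting on it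
    [NormedAddCommGroup E'] [NormedSpace ℝ E'] [FiniteDimensional ℝ E']
    [TopologicalSpace Q'] [ChartedSpace E' Q'] [IsManifold 𝓘(ℝ, E') ∞ Q']
    [NormedAddCommGroup EF] [NormedSpace ℝ EF] [FiniteDimensional ℝ EF]
    [TopologicalSpace F] [ChartedSpace EF F] [Group F] [LieGroup 𝓘(ℝ, EF) ∞ F]
    [MulAction F Q']
    (ρ : Q → Q') (pr : G →* F)
    (hred : IsReduction (EG := EG) (E := E) (EF := EF) (E' := E') GW ρ pr) :
    -- the partially reduced horizontal gauge symmetries, and the dual frame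
    let η : Fin k → Q' → GroupLieAlgebra 𝓘(ℝ, EF) F :=
      fun i => reducedSymmetry pr hred.surjective_base (ζ i)
    let μ : Fin k → Q' → Module.Dual ℝ (GroupLieAlgebra 𝓘(ℝ, EF) F) := dualFrame η
    -- they are well defined: `η` does not depend on the points chosen in the fibres of `ρ`
    (∀ i q, η i (ρ q) = lieProjection pr (ζ i q)) ∧
    (∀ i j x, μ i x (η j x) = if i = j then 1 else 0) ∧
    (∀ c : Fin k → ℝ,
      momentumLevelSet (E := E') (∑ i, c i • μ i) =
        ⋂ i, {α : CotangentBundle E' Q' | gaugeMomentum (η i) α = c i} ∧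
      (∀ h : F, ∀ α ∈ momentumLevelSet (E := E') (∑ i, c i • μ i),
        cotangentLift h α ∈ momentumLevelSet (E := E') (∑ i, c i • μ i)) ∧
      IsEmbeddedSubmanifold (cotangentModel E')
        (momentumLevelSet (E := E') (∑ i, c i • μ i)) k) ∧
    IsFoliation (cotangentModel E')
      {L : Set (CotangentBundle E' Q') | ∃ ν ∈ Submodule.span ℝ (Set.range μ),
        ∃ α ∈ momentumLevelSet (E := E') ν,
          L = connectedComponentIn (momentumLevelSet (E := E') ν) α} k := by
  have := FiniteDimensional.complete ℝ E'
  have := FiniteDimensional.complete ℝ EF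
  exact proposition3p1_general hfree (fun q => (hW.isCompl q).disjoint.mono_left inf_le_left)
    hW.inf_verticalSpace_sup hW.eq_tangent (hζ.isInvariantFrame hsymm) hred
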